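/- **Setting.** Let $N,n\ge 0$ and $M\ge 1$ be integers and $\Theta$ a set. Agent $i\in\{1,\dots,N\}$ has a strategy set $\mathcal X_i\subset\mathbb R^n$; put $\mathcal X=\mathcal X_1\times\cdots\times\mathcal X_N\subset\mathbb R^{nN}$. Let $f_i:\mathbb R^{nN}\to\mathbb R$ and $g:\mathbb R^{nN}\times\Theta\to\mathbb R$. For $\theta=(\theta_1,\dots,\theta_M)\in\Theta^M$ let $\Omega(\theta)$ be the set of Nash equilibria of the game in which agent $i$ minimises $J_i(x_i,x_{-i})=f_i(x_i,x_{-i})+\max_m g(x_i,x_{-i},\theta_m)$ over $x_i\in\mathcal X_i$, i.e. the set of $x^*\in\mathcal X$ with $x_i^*\in\arg\min_{x_i\in\mathcal X_i}J_i(x_i,x^*_{-i})$ for all $i$. **Assumption.** (i) Each $\mathcal X_i$ is nonempty, compact and convex, and for all $\vartheta\in\Theta$, $i$ and $x_{-i}\in\prod_{j\ne i}\mathcal X_j$ the function $f_i(\cdot,x_{-i})+g(\cdot,x_{-i},\vartheta)$ is convex on $\mathcal X_i$. (ii) Every $f_i$ and every $g(\cdot,\vartheta)$ is twice differentiable on an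 open convex set containing $\mathcal X$. (iii) There are $\chi^f,\chi^g\in\mathbb R$ with $\chi^f+\chi^g\ge 0$ such that for all $u,v\in\mathcal X$ and $\vartheta\in\Theta$: $(u-v)^\top\big((\nabla_{x_i}f_i(u))_i-(\nabla_{x_i}f_i(v))_i\big)\ge\chi^f\|u-v\|^2$ and $(u-v)^\top(\nabla_x g(u,\vartheta)-\nabla_x g(v,\vartheta))\ge\chi^g\|u-v\|^2$. **Notation.** Let $\Delta\subset\mathbb R^M$ be the probability simplex, $\hat g(x,y)=\sum_m y_m g(x,\theta_m)$, and $F(x,y)=\big((\nabla_{x_i}f_i(x)+\nabla_{x_i}\hat g(x,y))_i,\,-\nabla_y\hat g(x,y)\big)$. The augmented VI asks for $z^*\in\mathcal X\times\Delta$ with $(z-z^*)^\top F(z^*)\ge 0$ for all $z\in\mathcal X\times\Delta$. For $\tau>0$, $\eta\ge 0$ and a centre $\bar z=(\bar x,\bar y)\in\mathcal X\times\Delta$, the regularised game has $N+1$ players: given $(x,y)$, agent $i$ minimises $f_i(\nu,x_{-i})+\hat g(\nu,x_{-i},y)+\frac\eta2\|(\nu,x_{-i},y)\|^2+\frac\tau2\|\nu-\bar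 x_i\|^2$ over $\nu\in\mathcal X_i$, and the additional player maximises $\hat g(x,\nu)-\frac\eta2\|(x,\nu)\|^2-\frac\tau2\|\nu-\bar y\|^2$ over $\nu\in\Delta$. **Proposition.** Under the Assumption there is a single-valued mapping $\Phi$ assigning to every $\theta\in\Theta^M$ a point $\Phi(\theta)\in\Omega(\theta)$ such that, for every $\theta$, there is $z^*\in\mathcal X\times\Delta$ with the following properties. 1. $z^*$ is the unique minimiser of $\frac12\|z\|^2$ over the solutions of the augmented VI, and $\Phi(\theta)$ is its $x$-component. 2. For all $\tau>0$, $\eta\ge 0$ and $\bar z\in\mathcal X\times\Delta$ the regularised game has exactly one Nash equilibrium, denoted $S^{\tau}_{\eta}(\bar z)$. 3. (Proximal–Tikhonov iteration.) Let $\tau>0$, $\eta^{(k)}>0$, $\sum_k\eta^{(k)}=\infty$, $\eta^{(k)}\to 0$, $\varepsilon^{(k)}\ge 0$, $\sum_k\varepsilon^{(k)}<\infty$. Every sequence $(\bar z^{(k)})$ in $\mathcal X\times\Delta$ with $\|\bar z^{(k+1)}-S^\tau_{\eta^{(k)}}(\bar z^{(k)})\|\le\varepsilon^{(k)}$ for all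 $k$ converges to $z^*$. 4. (Decentralised algorithm.) Suppose moreover that the second derivatives of the $f_i$ and $g(\cdot,\theta_m)$ are continuous on an open convex set containing $\mathcal X$. Then there is $\bar\tau>0$ such that for every $\tau\ge\bar\tau$: (a) for all $\eta\ge0$, $\gamma>0$, every centre and every starting point in $\mathcal X\times\Delta$, the inner loop, which lets all $N+1$ players of the regularised game simultaneously replace their strategies by their optimal replies to the current strategies of the others until two consecutive iterates are at distance at most $\gamma$, is well defined and stops, with a unique output; (b) if $\eta^{(k)}$ is as in 3, $\gamma^{(k)}>0$ and $\sum_k\gamma^{(k)}<\infty$, then every sequence $\bar z^{(k)}$, $\bar z^{(0)}\in\mathcal X\times\Delta$, in which $\bar z^{(k+1)}$ is the output of an inner loop with centre $\bar z^{(k)}$, weight $\eta^{(k)}$, tolerance $\gamma^{(k)}$ and an arbitrary starting point in $\mathcal X\times\Delta$, converges to $z^*$; in particular, for every $\gamma_{\rm out}>0$ the outer stopping test $\|\bar z^{(k+1)}-\bar z^{(k)}\|\le\gamma_{\rm out}$ is met for some $k$. -/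

import Mathlib

open Set Filter Topology

noncomputable section

/-- Joint strategies `x = (x_i)` of `N` agents, `x_i ∈ ℝⁿ`, with the Euclidean norm of `ℝ^{nN}`. -/
abbrev JointStrategy (N n : ℕ) : Type :=
  PiLp 2 (fun _ : Fin N => EuclideanSpace ℝ (Fin n))

/-- Pairs `z = (x, y)` in `ℝ^{nN} × ℝ^M`, with the Euclidean norm of `ℝ^{nN+M}`. -/
abbrev AugmentedStrategy (N n M : ℕ) : Type :=
  WithLp 2 (JointStrategy N n × EuclideanSpace ℝ (Fin M))

/-- The pair `(x, y)`. -/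
def augPair {N n M : ℕ} (x : JointStrategy N n) (y : EuclideanSpace ℝ (Fin M)) :
    AugmentedStrategy N n M :=
  WithLp.toLp 2 (x, y)

/-- `(ν, x_{-i})`: the joint strategy `x` with the strategy of agent `i` replaced by `ν`. -/
def deviate {N n : ℕ} (x : JointStrategy N n) (i : Fin N) (ν : EuclideanSpace ℝ (Fin n)) :
    JointStrategy N n :=
  WithLp.toLp 2 (Function.update x.ofLp i ν)

/-- The probability simplex of `ℝ^M`. -/
def simplex (M : ℕ) : Set (EuclideanSpace ℝ (Fin M)) :=
  {y | (∀ m, 0 ≤ y m) ∧ ∑ m, y m = 1}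

/-- `h` is twice differentiable on some open convex set containing `S`. -/
def TwiceDifferentiableNear {N n : ℕ} (S : Set (JointStrategy N n))
    (h : JointStrategy N n → ℝ) : Prop :=
  ∃ U : Set (JointStrategy N n), IsOpen U ∧ Convex ℝ U ∧ S ⊆ U ∧
    DifferentiableOn ℝ h U ∧ DifferentiableOn ℝ (fderiv ℝ h) U

/-- `h` is twice continuously differentiable on some open convex set containing `S`. -/
def TwiceContDifferentiableNear {N n : ℕ} (S : Set (JointStrategy N n))
    (h : JointStrategy N n → ℝ) : Prop :=
  ∃ U : Set (JointStrategy N n), IsOpen U ∧ Convex ℝ U ∧ S ⊆ U ∧ ContDiffOn ℝ 2 h U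

/-- The data of the game: local constraint sets `X i`, deterministic costs `f i`,
and the common uncertain cost `g`. -/
structure ScenarioGame (N n : ℕ) (Θ : Type*) where
  X : Fin N → Set (EuclideanSpace ℝ (Fin n))
  f : Fin N → JointStrategy N n → ℝ
  g : JointStrategy N n → Θ → ℝ

namespace ScenarioGame

variable {N n M : ℕ} {Θ : Type*} (G : ScenarioGame N n Θ) (θ : Fin M → Θ)

/-- The set `X = X_1 × ⋯ × X_N` of joint strategies. -/
def strategies : Set (JointStrategy N n) := {x | ∀ i, x i ∈ G.X i}

/-- The pseudo-gradient `(∇_{x_i} f_i(x))_i`; block `i` is block `i` of the gradient of `f_i`. -/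
def pseudoGradient (x : JointStrategy N n) : JointStrategy N n :=
  WithLp.toLp 2 (fun i => (gradient (G.f i) x) i)

/-- The standing assumptions on the game. (Continuous differentiability of
`f_i(·, x_{-i}) + g(·, x_{-i}, ϑ)` is a consequence of `diff_f` and `diff_g`.) -/
structure StandingAssumption : Prop where
  nonempty : ∀ i, (G.X i).Nonempty
  compact : ∀ i, IsCompact (G.X i)
  convex : ∀ i, Convex ℝ (G.X i)
  convex_cost : ∀ (i : Fin N) (ϑ : Θ), ∀ x ∈ G.strategies,
    ConvexOn ℝ (G.X i) (fun ν => G.f i (deviate x i ν) + G.g (deviate x i ν) ϑ)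
  diff_f : ∀ i, TwiceDifferentiableNear G.strategies (G.f i)
  diff_g : ∀ ϑ, TwiceDifferentiableNear G.strategies (fun x => G.g x ϑ)
  monotone : ∃ χf χg : ℝ, 0 ≤ χf + χg ∧
    (∀ u ∈ G.strategies, ∀ v ∈ G.strategies,
      χf * ‖u - v‖ ^ 2 ≤ inner ℝ (u - v) (G.pseudoGradient u - G.pseudoGradient v)) ∧
    (∀ ϑ, ∀ u ∈ G.strategies, ∀ v ∈ G.strategies,
      χg * ‖u - v‖ ^ 2 ≤
        inner ℝ (u - v) (gradient (fun x => G.g x ϑ) u - gradient (fun x => G.g x ϑ) v))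

/-- `J_i(x) = f_i(x) + max_m g(x, θ_m)`; the supremum is a maximum as soon as `M ≥ 1`. -/
def cost (i : Fin N) (x : JointStrategy N n) : ℝ :=
  G.f i x + ⨆ m, G.g x (θ m)

/-- The set of Nash equilibria of the scenario game with samples `θ_1, …, θ_M`. -/
def nashSet : Set (JointStrategy N n) :=
  {x | x ∈ G.strategies ∧
    ∀ i, ∀ ν ∈ G.X i, G.cost θ i (deviate x i (x i)) ≤ G.cost θ i (deviate x i ν)}

/-- `ĝ(x, y) = ∑_m y_m g(x, θ_m)`. -/
def gHat (x : JointStrategy N n) (y : EuclideanSpace ℝ (Fin M)) : ℝ :=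
  ∑ m, y m * G.g x (θ m)

/-- The feasible set `X × Δ` of the augmented game. -/
def feasible (M : ℕ) : Set (AugmentedStrategy N n M) :=
  {z | z.fst ∈ G.strategies ∧ z.snd ∈ simplex M}

/-- The operator `F(x, y) = ((∇_{x_i} f_i(x) + ∇_{x_i} ĝ(x, y))_i, -∇_y ĝ(x, y))`. -/
def augOperator (z : AugmentedStrategy N n M) : AugmentedStrategy N n M :=
  augPair (G.pseudoGradient z.fst + gradient (fun x => G.gHat θ x z.snd) z.fst)
    (-gradient (fun y => G.gHat θ z.fst y) z.snd)

/-- The solution set of the variational inequality `VI(F, X × Δ)`. -/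
def viSolutions : Set (AugmentedStrategy N n M) :=
  {zs | zs ∈ G.feasible M ∧ ∀ z ∈ G.feasible M, 0 ≤ inner ℝ (z - zs) (G.augOperator θ zs)}

/-- The solutions of `VI(F, X × Δ)` that minimise `½‖·‖²` among all its solutions. -/
def minNormSolutions : Set (AugmentedStrategy N n M) :=
  {zs | zs ∈ G.viSolutions θ ∧
    ∀ z ∈ G.viSolutions θ, (1 / 2 : ℝ) * ‖zs‖ ^ 2 ≤ (1 / 2 : ℝ) * ‖z‖ ^ 2}

/-- Objective of agent `i` in the regularised augmented game with centre `c`, as a function of its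
own strategy `ν`, when the others play as in `w`:
`f_i(ν, x_{-i}) + ĝ(ν, x_{-i}, y) + (η/2)‖(ν, x_{-i}, y)‖² + (τ/2)‖ν - c_i‖²`. -/
def regAgentCost (τ η : ℝ) (c w : AugmentedStrategy N n M) (i : Fin N)
    (ν : EuclideanSpace ℝ (Fin n)) : ℝ :=
  G.f i (deviate w.fst i ν) + G.gHat θ (deviate w.fst i ν) w.snd
    + η / 2 * ‖augPair (deviate w.fst i ν) w.snd‖ ^ 2 + τ / 2 * ‖ν - c.fst i‖ ^ 2

/-- Objective, to be maximised, of the additional agent in the regularised augmented game: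
`ĝ(x, ν) - (η/2)‖(x, ν)‖² - (τ/2)‖ν - c_y‖²`. -/
def regCoordPayoff (τ η : ℝ) (c w : AugmentedStrategy N n M) (ν : EuclideanSpace ℝ (Fin M)) : ℝ :=
  G.gHat θ w.fst ν - η / 2 * ‖augPair w.fst ν‖ ^ 2 - τ / 2 * ‖ν - c.snd‖ ^ 2

/-- One simultaneous (Jacobi) update: `w'` consists of optimal replies of all `N + 1` agents
of the regularised augmented game to `w`. -/
def IsBestResponse (τ η : ℝ) (c w w' : AugmentedStrategy N n M) : Prop :=
  (∀ i, w'.fst i ∈ G.X i ∧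
    ∀ ν ∈ G.X i, G.regAgentCost θ τ η c w i (w'.fst i) ≤ G.regAgentCost θ τ η c w i ν) ∧
  (w'.snd ∈ simplex M ∧
    ∀ ν ∈ simplex M, G.regCoordPayoff θ τ η c w ν ≤ G.regCoordPayoff θ τ η c w w'.snd)

/-- `z` is a Nash equilibrium of the regularised augmented game with centre `c`. -/
def IsRegNash (τ η : ℝ) (c z : AugmentedStrategy N n M) : Prop :=
  G.IsBestResponse θ τ η c z z

/-- The inner loop with centre `c`, started at `w₀`, stops with output `out`: best responses are
iterated, and the first iterate `w_{L+1}` with `‖w_{L+1} - w_L‖ ≤ γ` is returned. -/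
def IsInnerOutput (τ η γ : ℝ) (c w₀ out : AugmentedStrategy N n M) : Prop :=
  ∃ (w : ℕ → AugmentedStrategy N n M) (L : ℕ), w 0 = w₀ ∧
    (∀ l ≤ L, G.IsBestResponse θ τ η c (w l) (w (l + 1))) ∧
    (∀ l < L, γ < ‖w (l + 1) - w l‖) ∧ ‖w (L + 1) - w L‖ ≤ γ ∧ out = w (L + 1)

/-- `zbar` is a sequence of outer iterates of the algorithm: `zbar (k+1)` is the output of an
inner loop with centre `zbar k`, weight `η k` and tolerance `γ k`, started anywhere in `X × Δ`. -/
def IsRun (τ : ℝ) (η γ : ℕ → ℝ) (zbar : ℕ → AugmentedStrategy N n M) : Prop :=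
  zbar 0 ∈ G.feasible M ∧
    ∀ k, ∃ w₀ ∈ G.feasible M, G.IsInnerOutput θ τ (η k) (γ k) (zbar k) w₀ (zbar (k + 1))

/-- Admissible Tikhonov weights: positive, not summable, and tending to `0`. -/
def IsTikhonovSeq (η : ℕ → ℝ) : Prop :=
  (∀ k, 0 < η k) ∧ Tendsto (fun K => ∑ k ∈ Finset.range K, η k) atTop atTop ∧
    Tendsto η atTop (𝓝 0)

end ScenarioGame

end

/-!
The Nash equilibria are selected through the augmented game, in which an additional player chooses
the weights `y` of the samples. Its variational inequality (VI) is monotone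
(`StandingAssumption.monotone_augOperator`): in
`⟪u - v, F u - F v⟫` the coupling through `∑ y_m g(x, θ_m)` cancels up to `χg ‖x - x'‖²`, because
each `g(·, ϑ)` lies above its quadratic lower models of curvature `χg`, and `χf + χg ≥ 0`. Hence by
Minty's lemma its solution set is convex and compact, and it is nonempty because the finite
subsystems of the dual VI are solvable by the minimax theorem (`viSet_nonempty`); no fixed point
theorem is needed. So there is exactly one solution of least norm, the projection `p` of `0` on the
solution set, and by the first-order conditions its `x`-part is a Nash equilibrium of the scenario
game.

For `τ, η ≥ 0` the equilibria of the regularised game are the solutions of the VI of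
`F + η • id + τ • (id - c)` (`StandingAssumption.isRegNash_iff`), which is strongly monotone if
`τ > 0`. With `s` the solution for the centre `c`, monotonicity tested at `p` gives
`(1 + 2η/τ) ‖s - p‖² ≤ ‖c - p‖² - ‖c - s‖² - (2η/τ) ⟪p, s - p⟫`.
A long step decreases `‖· - p‖²` by a fixed amount; a short step with small `η` ends near the
solution set, where `⟪p, s - p⟫` is almost nonnegative. Either way the excess of `‖· - p‖²` over a
given `δ > 0` shrinks by a factor `1 - η/τ`, and `∑ η = ∞` forces convergence to `p`, up to
summable errors (`tendsto_proxTikhonov`). No condition on the variation of `η` is used.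

For the decentralised algorithm, `C²` data make `F` Lipschitz on the compact feasible set. Each
optimal reply solves a VI that is strongly monotone with modulus at least `τ` and depends on the
strategies of the others through `F` only, so for large `τ` the simultaneous replies contract with
factor `1/2` (`StandingAssumption.exists_contracting`). The inner loop then stops within its own
tolerance of the equilibrium, and the outer iterates form an inexact proximal-Tikhonov iteration.
-/

open Set Filter Topology

/-! ### Monotone variational inequalities on compact convex sets -/

section VariationalInequality

variable {H : Type*} [NormedAddCommGroup H] [InnerProductSpace ℝ H]

/-- The solutions of the variational inequality `VI(A, K)`: the points `z ∈ K` with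
`⟪w - z, A z⟫ ≥ 0` for all `w ∈ K`. -/
def viSet (A : H → H) (K : Set H) : Set H :=
  {z | z ∈ K ∧ ∀ w ∈ K, 0 ≤ inner ℝ (w - z) (A z)}

/-- `A` is a monotone operator on `K`. -/
def MonotoneOperatorOn (A : H → H) (K : Set H) : Prop :=
  ∀ u ∈ K, ∀ v ∈ K, 0 ≤ inner ℝ (u - v) (A u - A v)

/-- The operator `A + η • id + τ • (id - c)` of the regularised problem with centre `c`. -/
noncomputable def regOperator (A : H → H) (τ η : ℝ) (c z : H) : H :=
  A z + η • z + τ • (z - c)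

variable {A : H → H} {K : Set H}

/-- **Minty's lemma**: for a continuous monotone operator, the variational inequality is
equivalent to its dual form, in which the operator is evaluated at the test point. -/
theorem mem_viSet_iff_minty (hK : Convex ℝ K) (hc : ContinuousOn A K)
    (hm : MonotoneOperatorOn A K) {z : H} :
    z ∈ viSet A K ↔ z ∈ K ∧ ∀ w ∈ K, 0 ≤ inner ℝ (w - z) (A w) := by
  constructor
  · rintro ⟨hz, h⟩
    refine ⟨hz, fun w hw => ?_⟩
    have h1 := h w hw
    have h2 := hm w hw z hz
    rw [inner_sub_right] at h2
    linarith
  · rintro ⟨hz, h⟩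
    refine ⟨hz, fun w hw => ?_⟩
    have hmem : ∀ t ∈ Icc (0 : ℝ) 1, z + t • (w - z) ∈ K := fun t ht =>
      hK.add_smul_sub_mem hz hw ht
    have hcont : ContinuousOn (fun t : ℝ => inner ℝ (w - z) (A (z + t • (w - z)))) (Icc 0 1) := by
      refine ContinuousOn.inner continuousOn_const (hc.comp (by fun_prop) hmem)
    have hlim : Tendsto (fun t : ℝ => inner ℝ (w - z) (A (z + t • (w - z)))) (𝓝[>] 0)
        (𝓝 (inner ℝ (w - z) (A z))) := by
      have h0 := (hcont 0 (by simp)).mono_left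
        (nhdsWithin_mono (0 : ℝ) (Ioc_subset_Icc_self : Ioc (0 : ℝ) 1 ⊆ Icc 0 1))
      rw [nhdsWithin_Ioc_eq_nhdsGT zero_lt_one] at h0
      simpa using h0
    refine ge_of_tendsto hlim ?_
    filter_upwards [Ioc_mem_nhdsGT (zero_lt_one (α := ℝ))] with t ht
    have h1 := h _ (hmem t ⟨ht.1.le, ht.2⟩)
    rw [add_sub_cancel_left, real_inner_smul_left] at h1
    exact nonneg_of_mul_nonneg_right h1 ht.1

/-- A square matrix whose symmetric part has nonnegative entries maps some probability vector into
the nonnegative orthant. The vector comes from a saddle point of the bilinear game it defines. -/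
theorem exists_stdSimplex_mulVec_nonneg {ι : Type*} [Fintype ι] [Nonempty ι] (a : ι → ι → ℝ)
    (ha : ∀ i j, 0 ≤ a i j + a j i) :
    ∃ l ∈ stdSimplex ℝ ι, ∀ i, 0 ≤ ∑ j, a i j * l j := by
  classical
  have hcv : Convex ℝ (stdSimplex ℝ ι) := convex_stdSimplex ℝ ι
  have hcpt : IsCompact (stdSimplex ℝ ι) := isCompact_stdSimplex ℝ ι
  have hne : (stdSimplex ℝ ι).Nonempty :=
    ⟨_, single_mem_stdSimplex ℝ (Classical.arbitrary ι)⟩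
  let f : (ι → ℝ) → (ι → ℝ) → ℝ := fun x y => ∑ i, x i * ∑ j, a i j * y j
  let L : (ι → ℝ) → (ι → ℝ) →ₗ[ℝ] ℝ := fun x =>
    { toFun := f x
      map_add' := fun u v => by
        simp only [f, Pi.add_apply, mul_add, Finset.sum_add_distrib]
      map_smul' := fun r u => by
        simp only [f, Pi.smul_apply, smul_eq_mul, RingHom.id_apply, Finset.mul_sum]
        exact Finset.sum_congr rfl fun i _ => Finset.sum_congr rfl fun j _ => by ring }
  let R : (ι → ℝ) → (ι → ℝ) →ₗ[ℝ] ℝ := fun y =>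
    { toFun := fun x => f x y
      map_add' := fun u v => by
        simp only [f, Pi.add_apply, add_mul, Finset.sum_add_distrib]
      map_smul' := fun r u => by
        simp only [f, Pi.smul_apply, smul_eq_mul, RingHom.id_apply, Finset.mul_sum]
        exact Finset.sum_congr rfl fun i _ => Finset.sum_congr rfl fun j _ => by ring }
  obtain ⟨x, hx, y, hy, hs⟩ := Sion.exists_isSaddlePointOn (f := f) hne hcv hcpt
    (fun y _ => Continuous.lowerSemicontinuous (by fun_prop) |>.lowerSemicontinuousOn _)
    (fun y _ => ((R y).convexOn hcv).quasiconvexOn)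
    hcv hne hcpt
    (fun x _ => Continuous.upperSemicontinuous (by fun_prop) |>.upperSemicontinuousOn _)
    (fun x _ => ((L x).concaveOn hcv).quasiconcaveOn)
  refine ⟨y, hy, fun i => ?_⟩
  have h1 : f x x ≤ f (Pi.single i 1) y := hs _ (single_mem_stdSimplex ℝ i) _ hx
  have h2 : f (Pi.single i 1) y = ∑ j, a i j * y j := by
    simp [f, Pi.single_apply]
  have h3 : f x x = ∑ i, ∑ j, x i * x j * a i j := by
    simp only [f, Finset.mul_sum]
    exact Finset.sum_congr rfl fun i _ => Finset.sum_congr rfl fun j _ => by ring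
  have h4 : 0 ≤ f x x + f x x := by
    conv_rhs => rw [h3]; arg 2; rw [Finset.sum_comm]
    simp only [← Finset.sum_add_distrib]
    refine Finset.sum_nonneg fun i _ => Finset.sum_nonneg fun j _ => ?_
    have := mul_nonneg (mul_nonneg (hx.1 i) (hx.1 j)) (ha i j)
    linarith
  linarith

/-- A variational inequality with a continuous monotone operator on a nonempty compact convex set
has a solution. By Minty's lemma it has to be shown that the half-spaces of the dual form meet in
`K`; by compactness finitely many are enough, and for these a suitable convex combination of the
test points works. -/
theorem viSet_nonempty (hne : K.Nonempty) (hcpt : IsCompact K) (hK : Convex ℝ K)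
    (hc : ContinuousOn A K) (hm : MonotoneOperatorOn A K) : (viSet A K).Nonempty := by
  have key : (K ∩ ⋂ w : K, {z | 0 ≤ inner ℝ ((w : H) - z) (A w)}).Nonempty := by
    refine hcpt.inter_iInter_nonempty _ (fun w => isClosed_le continuous_const (by fun_prop)) ?_
    intro s
    rcases s.eq_empty_or_nonempty with rfl | hs
    · simpa using hne
    have : Nonempty s := hs.to_subtype
    obtain ⟨l, hl, hl'⟩ := exists_stdSimplex_mulVec_nonneg
      (fun i j : s => inner ℝ ((i : K) - (j : K) : H) (A (i : K))) (by
        intro i j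
        have h := hm _ (i : K).2 _ (j : K).2
        rw [← neg_sub ((i : K) : H), inner_neg_left]
        rw [inner_sub_right] at h
        linarith)
    refine ⟨∑ j, l j • ((j : K) : H),
      hK.sum_mem (fun j _ => hl.1 j) hl.2 (fun j _ => (j : K).2), ?_⟩
    simp only [mem_iInter, mem_ofPred_eq]
    intro w hw
    have h := hl' ⟨w, hw⟩
    have e : ((w : H) - ∑ j, l j • ((j : K) : H)) = ∑ j, l j • ((w : H) - ((j : K) : H)) := by
      simp only [smul_sub, Finset.sum_sub_distrib, ← Finset.sum_smul, hl.2, one_smul]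
    rw [e, sum_inner]
    refine h.trans_eq (Finset.sum_congr rfl fun j _ => ?_)
    rw [real_inner_smul_left, mul_comm]
  obtain ⟨z, hz, h⟩ := key
  refine ⟨z, (mem_viSet_iff_minty hK hc hm).2 ⟨hz, fun w hw => ?_⟩⟩
  simpa using mem_iInter.1 h ⟨w, hw⟩

theorem convex_viSet (hK : Convex ℝ K) (hc : ContinuousOn A K) (hm : MonotoneOperatorOn A K) :
    Convex ℝ (viSet A K) := by
  intro u hu v hv a b ha hb hab
  rw [mem_viSet_iff_minty hK hc hm] at *
  refine ⟨hK hu.1 hv.1 ha hb hab, fun w hw => ?_⟩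
  have e : w - (a • u + b • v) = a • (w - u) + b • (w - v) := by
    rw [smul_sub, smul_sub, sub_add_sub_comm, ← add_smul, hab, one_smul]
  rw [e, inner_add_left, real_inner_smul_left, real_inner_smul_left]
  exact add_nonneg (mul_nonneg ha (hu.2 w hw)) (mul_nonneg hb (hv.2 w hw))

theorem isCompact_viSet (hcpt : IsCompact K) (hK : Convex ℝ K) (hc : ContinuousOn A K)
    (hm : MonotoneOperatorOn A K) : IsCompact (viSet A K) := by
  have e : viSet A K = K ∩ ⋂ w ∈ K, {z | 0 ≤ inner ℝ (w - z) (A w)} := by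
    ext z
    rw [mem_viSet_iff_minty hK hc hm]
    simp
  rw [e]
  exact hcpt.inter_right (isClosed_biInter fun w _ =>
    isClosed_le continuous_const (by fun_prop))

/-- A nonempty compact convex set `C` has a unique element of least norm, and it is the projection
of `0` onto `C`. -/
theorem exists_unique_min_norm {C : Set H} (hne : C.Nonempty) (hcpt : IsCompact C)
    (hC : Convex ℝ C) :
    ∃ p ∈ C, (∀ q ∈ C, 0 ≤ inner ℝ p (q - p)) ∧ {z | z ∈ C ∧
      ∀ q ∈ C, (1 / 2 : ℝ) * ‖z‖ ^ 2 ≤ (1 / 2 : ℝ) * ‖q‖ ^ 2} = {p} := by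
  obtain ⟨p, hp, hpn⟩ := exists_norm_eq_iInf_of_complete_convex hne hcpt.isComplete hC 0
  rw [norm_eq_iInf_iff_real_inner_le_zero hC hp] at hpn
  have hpr : ∀ q ∈ C, 0 ≤ inner ℝ p (q - p) := fun q hq => by
    have := hpn q hq
    rw [zero_sub, inner_neg_left] at this
    linarith
  have hexp : ∀ q, ‖q‖ ^ 2 = ‖p‖ ^ 2 + 2 * inner ℝ p (q - p) + ‖q - p‖ ^ 2 := fun q => by
    rw [← norm_add_sq_real, add_sub_cancel]
  refine ⟨p, hp, hpr, Subset.antisymm ?_ ?_⟩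
  · rintro z ⟨hz, hmin⟩
    have h1 := hmin p hp
    have h2 := hexp z
    have h3 := hpr z hz
    have h4 : ‖z - p‖ ^ 2 = 0 := le_antisymm (by linarith) (sq_nonneg _)
    exact sub_eq_zero.1 (norm_eq_zero.1 (pow_eq_zero_iff two_ne_zero |>.1 h4))
  · rintro z rfl
    refine ⟨hp, fun q hq => ?_⟩
    have h2 := hexp q
    have h3 := hpr q hq
    have h4 := sq_nonneg ‖q - z‖
    linarith

theorem continuousOn_regOperator (hc : ContinuousOn A K) (τ η : ℝ) (c : H) :
    ContinuousOn (regOperator A τ η c) K := by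
  unfold regOperator
  fun_prop

/-- The regularised operator is strongly monotone with modulus `η + τ`. -/
theorem regOperator_strongly_monotone (hm : MonotoneOperatorOn A K) (τ η : ℝ) (c : H) {u v : H}
    (hu : u ∈ K) (hv : v ∈ K) :
    (η + τ) * ‖u - v‖ ^ 2 ≤
      inner ℝ (u - v) (regOperator A τ η c u - regOperator A τ η c v) := by
  have e : regOperator A τ η c u - regOperator A τ η c v = (A u - A v) + (η + τ) • (u - v) := by
    simp only [regOperator]
    module
  rw [e, inner_add_right, real_inner_smul_right, real_inner_self_eq_norm_sq]
  linarith [hm u hu v hv]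

/-- The regularised variational inequality has exactly one solution. -/
theorem existsUnique_mem_viSet_regOperator (hne : K.Nonempty) (hcpt : IsCompact K)
    (hK : Convex ℝ K) (hc : ContinuousOn A K) (hm : MonotoneOperatorOn A K) {τ η : ℝ}
    (hτ : 0 < τ) (hη : 0 ≤ η) (c : H) : ∃! z, z ∈ viSet (regOperator A τ η c) K := by
  obtain ⟨z, hz⟩ := viSet_nonempty hne hcpt hK (continuousOn_regOperator hc τ η c) (by
    intro u hu v hv
    exact le_trans (by positivity) (regOperator_strongly_monotone hm τ η c hu hv))
  refine ⟨z, hz, fun w hw => ?_⟩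
  have h1 := hz.2 w hw.1
  have h2 := hw.2 z hz.1
  have h3 := regOperator_strongly_monotone hm τ η c hw.1 hz.1
  rw [← neg_sub w z, inner_neg_left] at h2
  rw [inner_sub_right] at h3
  have h4 : ‖w - z‖ ^ 2 = 0 := by
    refine le_antisymm ?_ (sq_nonneg _)
    by_contra! h
    nlinarith [mul_pos (add_pos_of_nonneg_of_pos hη hτ) h]
  exact sub_eq_zero.1 (norm_eq_zero.1 (pow_eq_zero_iff two_ne_zero |>.1 h4))

/-! ### Convergence of the proximal-Tikhonov iteration -/

/-- A nonnegative sequence that contracts by factors `1 - b k` with `∑ b = ∞`, up to summable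
errors, tends to zero. -/
theorem tendsto_zero_of_le_sub_mul_add {u b e : ℕ → ℝ} (hu : ∀ k, 0 ≤ u k) (hb : ∀ k, 0 ≤ b k)
    (he : ∀ k, 0 ≤ e k) (hes : Summable e)
    (hbs : Tendsto (fun n => ∑ k ∈ Finset.range n, b k) atTop atTop)
    (h : ∀ k, u (k + 1) ≤ u k - b k * u k + e k) : Tendsto u atTop (𝓝 0) := by
  -- adding the tail of the errors turns `u` into an antitone sequence
  let T : ℕ → ℝ := fun k => ∑' j, e (j + k)
  have hT : Tendsto T atTop (𝓝 0) := tendsto_sum_nat_add e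
  have hT0 : ∀ k, 0 ≤ T k := fun k => tsum_nonneg fun j => he _
  have hTs : ∀ k, T k = e k + T (k + 1) := fun k => by
    have := ((summable_nat_add_iff k).2 hes).tsum_eq_zero_add
    simpa [T, add_assoc, add_comm, add_left_comm] using this
  let v : ℕ → ℝ := fun k => u k + T k
  have hv : ∀ k, v (k + 1) + b k * u k ≤ v k := fun k => by
    have := h k
    have := hTs k
    simp only [v]
    linarith
  have hv0 : ∀ k, 0 ≤ v k := fun k => add_nonneg (hu k) (hT0 k)
  have hanti : Antitone v := antitone_nat_of_succ_le fun k => by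
    have := hv k
    have := mul_nonneg (hb k) (hu k)
    linarith
  have hlim := tendsto_atTop_ciInf hanti ⟨0, by rintro _ ⟨k, rfl⟩; exact hv0 k⟩
  set l := ⨅ k, v k
  have hul : Tendsto u atTop (𝓝 l) := by
    have := hlim.sub hT
    simpa [v] using this
  have hl0 : 0 ≤ l := ge_of_tendsto' hul hu
  rcases hl0.eq_or_lt with hl | hl
  · rwa [← hl] at hul
  exfalso
  -- if the limit were positive, the decrease `∑ b k * u k` would be infinite
  obtain ⟨k₀, hk₀⟩ := eventually_atTop.1 (hul.eventually (lt_mem_nhds (half_lt_self hl)))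
  have hsum : ∀ n, v (k₀ + n) + l / 2 * (∑ k ∈ Finset.range n, b (k₀ + k)) ≤ v k₀ := by
    intro n
    induction n with
    | zero => simp
    | succ n ih =>
      rw [Finset.sum_range_succ]
      have h1 := hv (k₀ + n)
      have h2 := mul_le_mul_of_nonneg_left (hk₀ (k₀ + n) (by omega)).le (hb (k₀ + n))
      rw [← add_assoc]
      linarith
  obtain ⟨n, hn, hn'⟩ := (((tendsto_atTop.1 hbs
    (2 * v k₀ / l + ∑ k ∈ Finset.range k₀, b k + 1)).and (eventually_ge_atTop k₀))).exists
  obtain ⟨m, rfl⟩ := Nat.exists_eq_add_of_le hn'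
  rw [Finset.sum_range_add] at hn
  have h1 := hsum m
  have h2 := hv0 (k₀ + m)
  have h3 : 2 * v k₀ / l < ∑ k ∈ Finset.range m, b (k₀ + k) := by linarith
  rw [div_lt_iff₀ hl] at h3
  linarith

/-- One proximal-Tikhonov step, tested against a solution `p` of the unregularised problem. -/
theorem proxTikhonov_step (hm : MonotoneOperatorOn A K) {p s c : H} {τ η : ℝ} (hτ : 0 < τ)
    (hp : p ∈ viSet A K) (hs : s ∈ viSet (regOperator A τ η c) K) :
    (1 + 2 * (η / τ)) * ‖s - p‖ ^ 2 ≤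
      ‖c - p‖ ^ 2 - ‖c - s‖ ^ 2 - 2 * (η / τ) * inner ℝ p (s - p) := by
  have h1 := hs.2 p hp.1
  have h2 := hp.2 s hs.1
  have h3 := hm s hs.1 p hp.1
  have e1 : inner ℝ (p - s) (regOperator A τ η c s) =
      -inner ℝ (s - p) (A s) - η * (‖s - p‖ ^ 2 + inner ℝ p (s - p))
        + τ * inner ℝ (s - p) (c - s) := by
    have e : regOperator A τ η c s = A s + η • ((s - p) + p) - τ • (c - s) := by
      simp only [regOperator]
      module
    rw [e, ← neg_sub s p, inner_neg_left, inner_sub_right, inner_add_right,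
      real_inner_smul_right, real_inner_smul_right, inner_add_right, real_inner_self_eq_norm_sq,
      real_inner_comm p]
    ring
  have e2 : ‖c - p‖ ^ 2 = ‖s - p‖ ^ 2 + 2 * inner ℝ (s - p) (c - s) + ‖c - s‖ ^ 2 := by
    rw [← norm_add_sq_real, sub_add_sub_cancel']
  rw [inner_sub_right] at h3
  have h4 : η / τ * (‖s - p‖ ^ 2 + inner ℝ p (s - p)) ≤ inner ℝ (s - p) (c - s) := by
    rw [div_mul_eq_mul_div, div_le_iff₀ hτ]
    linarith
  linarith

/-- If the regularised step is short and the weight `η` is small, then the step ends near the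
solution set of `VI(A, K)`, so `⟪p, s - p⟫` is almost nonnegative for `p` the projection of `0` on
that set. -/
theorem exists_inner_ge_of_short_step (hcpt : IsCompact K) (hc : ContinuousOn A K) {p : H}
    (hp : ∀ q ∈ viSet A K, 0 ≤ inner ℝ p (q - p)) (τ : ℝ) {δ : ℝ} (hδ : 0 < δ) :
    ∃ κ > 0, ∀ c ∈ K, ∀ η ≥ 0, η ≤ κ → ∀ s ∈ viSet (regOperator A τ η c) K, ‖s - c‖ ≤ κ →
      -δ ≤ inner ℝ p (s - p) := by
  by_contra! hcon
  choose c hcK η hη hηκ s hs hsc hlt using fun n : ℕ => hcon (1 / ((n : ℝ) + 1)) (by positivity)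
  obtain ⟨q, hq, φ, hφ, hlim⟩ := hcpt.tendsto_subseq fun n => (hs n).1
  have h0 : Tendsto (fun n => 1 / (((φ n : ℕ) : ℝ) + 1)) atTop (𝓝 0) :=
    tendsto_one_div_add_atTop_nhds_zero_nat.comp hφ.tendsto_atTop
  have hη0 : Tendsto (fun n => η (φ n)) atTop (𝓝 0) :=
    squeeze_zero (fun n => hη _) (fun n => hηκ _) h0
  have hsc0 : Tendsto (fun n => s (φ n) - c (φ n)) atTop (𝓝 0) :=
    squeeze_zero_norm (fun n => hsc _) h0
  have hA : Tendsto (fun n => A (s (φ n))) atTop (𝓝 (A q)) :=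
    (hc q hq).tendsto.comp (tendsto_nhdsWithin_iff.2 ⟨hlim, Eventually.of_forall fun n => (hs _).1⟩)
  have hreg : Tendsto (fun n => regOperator A τ (η (φ n)) (c (φ n)) (s (φ n))) atTop
      (𝓝 (A q)) := by
    have := (hA.add (hη0.smul hlim)).add (hsc0.const_smul τ)
    simpa [regOperator] using this
  have hqS : q ∈ viSet A K := by
    refine ⟨hq, fun w hw => ?_⟩
    exact ge_of_tendsto' ((tendsto_const_nhds.sub hlim).inner hreg) fun n => (hs (φ n)).2 w hw
  have h1 : Tendsto (fun n => inner ℝ p (s (φ n) - p)) atTop (𝓝 (inner ℝ p (q - p))) :=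
    tendsto_const_nhds.inner (hlim.sub tendsto_const_nhds)
  have h2 := le_of_tendsto' h1 fun n => (hlt (φ n)).le
  linarith [hp q hqS]

/-- **Convergence of the inexact proximal-Tikhonov iteration** to the projection `p` of `0` on
the solution set. For every `δ > 0`, the excess of `‖z k - p‖ ^ 2` over `δ` eventually contracts
by factors `1 - η k / τ`, up to summable errors: a long step decreases the distance to `p` by a
fixed amount, and a short step ends where the Tikhonov term pulls towards `p`. -/
theorem tendsto_proxTikhonov (hcpt : IsCompact K) (hc : ContinuousOn A K)
    (hm : MonotoneOperatorOn A K) {p : H} (hpS : p ∈ viSet A K)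
    (hp : ∀ q ∈ viSet A K, 0 ≤ inner ℝ p (q - p)) {τ : ℝ} (hτ : 0 < τ) {η ε : ℕ → ℝ}
    (hη : ∀ k, 0 < η k) (hηs : Tendsto (fun n => ∑ k ∈ Finset.range n, η k) atTop atTop)
    (hη0 : Tendsto η atTop (𝓝 0)) (hε : ∀ k, 0 ≤ ε k) (hεs : Summable ε) {z s : ℕ → H}
    (hz : ∀ k, z k ∈ K) (hs : ∀ k, s k ∈ viSet (regOperator A τ (η k) (z k)) K)
    (hzs : ∀ k, ‖z (k + 1) - s k‖ ≤ ε k) : Tendsto z atTop (𝓝 p) := by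
  obtain ⟨D, hD⟩ := hcpt.isBounded.exists_norm_le
  have hdist : ∀ u ∈ K, ∀ v ∈ K, ‖u - v‖ ≤ 2 * D := fun u hu v hv =>
    (norm_sub_le _ _).trans (by linarith [hD u hu, hD v hv])
  have hD0 : 0 ≤ D := (norm_nonneg p).trans (hD p hpS.1)
  suffices hmain : ∀ δ > 0, ∀ᶠ k in atTop, ‖z k - p‖ ^ 2 < 2 * δ by
    rw [Metric.tendsto_atTop']
    intro r hr
    obtain ⟨k₀, hk₀⟩ := eventually_atTop.1 (hmain (r ^ 2 / 2) (by positivity))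
    refine ⟨k₀, fun k hk => ?_⟩
    rw [dist_eq_norm]
    exact lt_of_pow_lt_pow_left₀ 2 hr.le (by linarith [hk₀ k hk.le])
  intro δ hδ
  obtain ⟨κ, hκ, hshort⟩ := exists_inner_ge_of_short_step hcpt hc hp τ hδ
  have hβ0 : Tendsto (fun k => η k / τ) atTop (𝓝 0) := by simpa using hη0.div_const τ
  -- the smallness of `η` needed below, for short and for long steps
  have hsmall : ∀ᶠ k in atTop, η k ≤ κ ∧ η k / τ ≤ 1 / 2 ∧
      η k / τ * (4 * D ^ 2 + 4 * D ^ 2) ≤ κ ^ 2 := by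
    refine (hη0.eventually (ge_mem_nhds hκ)).and
      ((hβ0.eventually (ge_mem_nhds (by norm_num))).and ?_)
    have : Tendsto (fun k => η k / τ * (4 * D ^ 2 + 4 * D ^ 2)) atTop (𝓝 0) := by
      simpa using hβ0.mul_const (4 * D ^ 2 + 4 * D ^ 2)
    exact this.eventually (ge_mem_nhds (by positivity))
  obtain ⟨k₀, hk₀⟩ := eventually_atTop.1 hsmall
  let u : ℕ → ℝ := fun k => max (‖z (k + k₀) - p‖ ^ 2 - δ) 0
  have hu : Tendsto u atTop (𝓝 0) := by
    refine tendsto_zero_of_le_sub_mul_add (b := fun k => η (k + k₀) / τ)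
      (e := fun k => 4 * D * ε (k + k₀)) (fun k => le_max_right _ _)
      (fun k => (div_pos (hη _) hτ).le) (fun k => by have := hε (k + k₀); positivity)
      (((summable_nat_add_iff k₀).2 hεs).mul_left _) ?_ ?_
    · have h1 := tendsto_atTop_add_const_right atTop (-∑ k ∈ Finset.range k₀, η k)
        (hηs.comp (tendsto_add_atTop_nat k₀))
      refine (h1.atTop_div_const hτ).congr fun n => ?_
      rw [← Finset.sum_div, Function.comp_apply, add_comm n k₀, Finset.sum_range_add]
      simp [add_comm]
    · intro k
      obtain ⟨hηκ, hβ2, hβD⟩ := hk₀ (k + k₀) (by omega)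
      set β := η (k + k₀) / τ
      have hβ : 0 < β := div_pos (hη _) hτ
      set c := z (k + k₀)
      set t := s (k + k₀)
      have hcK : c ∈ K := hz _
      have ht := hs (k + k₀)
      have hstep := proxTikhonov_step hm hτ hpS ht
      have hsq : ∀ w ∈ K, ‖w - p‖ ^ 2 ≤ 4 * D ^ 2 := fun w hw => by
        have := pow_le_pow_left₀ (norm_nonneg _) (hdist w hw p hpS.1) 2
        linarith
      -- the exact step
      have hexact : ‖t - p‖ ^ 2 - δ ≤ u k - β * u k := by
        have huk : ‖c - p‖ ^ 2 - δ ≤ u k := le_max_left _ _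
        have huk0 : 0 ≤ u k := le_max_right _ _
        rcases le_or_gt ‖t - c‖ κ with hsh | hlg
        · have hin := hshort c hcK _ (hη _).le hηκ t ht hsh
          have h1 : (1 + 2 * β) * (‖t - p‖ ^ 2 - δ) ≤ u k := by
            nlinarith [sq_nonneg ‖c - t‖]
          have h2 : u k ≤ (1 + 2 * β) * (u k - β * u k) := by
            nlinarith [mul_nonneg (mul_nonneg hβ.le huk0) (by linarith : 0 ≤ 1 - 2 * β)]
          exact le_of_mul_le_mul_left (h1.trans h2) (by linarith)
        · have h1 : κ ^ 2 ≤ ‖c - t‖ ^ 2 := by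
            rw [norm_sub_rev]
            exact pow_le_pow_left₀ hκ.le hlg.le 2
          have h2 : -(4 * D ^ 2) ≤ 2 * inner ℝ p (t - p) := by
            have h3 := neg_le_of_abs_le (abs_real_inner_le_norm p (t - p))
            have h4 := mul_le_mul (hD p hpS.1) (hdist t ht.1 p hpS.1) (norm_nonneg _) hD0
            linarith
          have h3 : β * u k ≤ β * (4 * D ^ 2) :=
            mul_le_mul_of_nonneg_left (max_le (by linarith [hsq c hcK]) (by positivity)) hβ.le
          nlinarith [mul_le_mul_of_nonneg_left h2 hβ.le, mul_nonneg hβ.le (sq_nonneg ‖t - p‖)]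
      -- the error of the step
      have herr : ‖z (k + 1 + k₀) - p‖ ^ 2 ≤ ‖t - p‖ ^ 2 + 4 * D * ε (k + k₀) := by
        have h1 : ‖z (k + 1 + k₀) - t‖ ≤ ε (k + k₀) := by
          have := hzs (k + k₀)
          rwa [add_right_comm] at this
        have h2 : ‖z (k + 1 + k₀) - p‖ ≤ ‖z (k + 1 + k₀) - t‖ + ‖t - p‖ :=
          norm_sub_le_norm_sub_add_norm_sub _ _ _
        have h3 := hdist _ (hz (k + 1 + k₀)) p hpS.1
        have h4 := hdist t ht.1 p hpS.1
        have h5 : (‖z (k + 1 + k₀) - p‖ - ‖t - p‖) * (‖z (k + 1 + k₀) - p‖ + ‖t - p‖) ≤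
            ε (k + k₀) * (4 * D) :=
          mul_le_mul (by linarith) (by linarith) (by positivity) (hε _)
        linarith
      have h6 : 0 ≤ u k - β * u k := by
        nlinarith [mul_nonneg (le_max_right _ _ : 0 ≤ u k) (by linarith : 0 ≤ 1 - 2 * β),
          (le_max_right _ _ : 0 ≤ u k)]
      have h7 : 0 ≤ 4 * D * ε (k + k₀) := by have := hε (k + k₀); positivity
      exact max_le (by linarith) (by linarith)
  have h1 := hu.eventually (gt_mem_nhds hδ)
  obtain ⟨k₁, hk₁⟩ := eventually_atTop.1 h1
  filter_upwards [eventually_ge_atTop (k₁ + k₀)] with k hk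
  have h2 := hk₁ (k - k₀) (by omega)
  have h3 : ‖z (k - k₀ + k₀) - p‖ ^ 2 - δ < δ := (le_max_left _ _).trans_lt h2
  rw [Nat.sub_add_cancel (by omega)] at h3
  linarith

end VariationalInequality

/-! ### First-order conditions for convex and weakly convex functions -/

section FirstOrder

variable {H : Type*} [NormedAddCommGroup H] [InnerProductSpace ℝ H] [CompleteSpace H]
  {S : Set H} {φ : H → ℝ}

theorem HasGradientAt.hasDerivAt_segment {v x w : H} {t : ℝ}
    (h : HasGradientAt φ v (x + t • (w - x))) :
    HasDerivAt (fun r : ℝ => φ (x + r • (w - x))) (inner ℝ (w - x) v) t := by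
  have h1 : HasDerivAt (fun r : ℝ => x + r • (w - x)) (w - x) t := by
    simpa using ((hasDerivAt_id t).smul_const (w - x)).const_add x
  have h2 := h.hasFDerivAt.comp_hasDerivAt t h1
  rwa [InnerProductSpace.toDual_apply_apply, real_inner_comm] at h2

theorem continuousAt_gradient_of_differentiableOn_fderiv {U : Set H} (hU : IsOpen U)
    (hd : DifferentiableOn ℝ (fderiv ℝ φ) U) {x : H} (hx : x ∈ U) :
    ContinuousAt (gradient φ) x :=
  ContinuousAt.comp (g := (InnerProductSpace.toDual ℝ H).symm)
    (LinearIsometryEquiv.continuous _).continuousAt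
    (hd.differentiableAt (hU.mem_nhds hx)).continuousAt

/-- A function whose gradient is monotone with modulus `χ` (of either sign) lies above its
quadratic lower models of curvature `χ`. -/
theorem add_inner_add_le_of_gradient_monotone (hS : Convex ℝ S)
    (hφ : ∀ x ∈ S, DifferentiableAt ℝ φ x) {χ : ℝ}
    (hm : ∀ u ∈ S, ∀ v ∈ S, χ * ‖u - v‖ ^ 2 ≤ inner ℝ (u - v) (gradient φ u - gradient φ v))
    {x w : H} (hx : x ∈ S) (hw : w ∈ S) :
    φ x + inner ℝ (w - x) (gradient φ x) + χ / 2 * ‖w - x‖ ^ 2 ≤ φ w := by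
  have hmem : ∀ t ∈ Icc (0 : ℝ) 1, x + t • (w - x) ∈ S := fun t ht =>
    hS.add_smul_sub_mem hx hw ht
  let p : ℝ → ℝ := fun t =>
    φ (x + t • (w - x)) - t * inner ℝ (w - x) (gradient φ x) - χ / 2 * ‖w - x‖ ^ 2 * t ^ 2
  have hp : ∀ t ∈ Icc (0 : ℝ) 1, HasDerivAt p (inner ℝ (w - x) (gradient φ (x + t • (w - x)))
      - inner ℝ (w - x) (gradient φ x) - χ * ‖w - x‖ ^ 2 * t) t := fun t ht => by
    have h1 := (hφ _ (hmem t ht)).hasGradientAt.hasDerivAt_segment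
    have h2 := (h1.sub ((hasDerivAt_id t).mul_const (inner ℝ (w - x) (gradient φ x)))).sub
      ((hasDerivAt_pow 2 t).const_mul (χ / 2 * ‖w - x‖ ^ 2))
    refine h2.congr_deriv ?_
    simp
    ring
  have hmono : MonotoneOn p (Icc 0 1) := by
    refine monotoneOn_of_deriv_nonneg (convex_Icc 0 1)
      (fun t ht => (hp t ht).continuousAt.continuousWithinAt)
      (fun t ht => (hp t (interior_subset ht)).differentiableAt.differentiableWithinAt) ?_
    intro t ht
    rw [(hp t (interior_subset ht)).deriv]
    rw [interior_Icc] at ht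
    have h1 := hm _ (hmem t ⟨ht.1.le, ht.2.le⟩) x hx
    rw [add_sub_cancel_left, real_inner_smul_left, norm_smul, mul_pow, Real.norm_eq_abs, sq_abs,
      inner_sub_right] at h1
    have h2 : t * (χ * ‖w - x‖ ^ 2 * t) ≤ t * (inner ℝ (w - x) (gradient φ (x + t • (w - x)))
      - inner ℝ (w - x) (gradient φ x)) := by linarith
    have h3 := le_of_mul_le_mul_left h2 ht.1
    linarith
  have h := hmono (left_mem_Icc.2 zero_le_one) (right_mem_Icc.2 zero_le_one) zero_le_one
  simp only [p, zero_smul, add_zero, one_smul, add_sub_cancel] at h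
  linarith

theorem ConvexOn.add_inner_le (hφ : ConvexOn ℝ S φ) {x v w : H} (hx : x ∈ S) (hw : w ∈ S)
    (h : HasGradientAt φ v x) : φ x + inner ℝ (w - x) v ≤ φ w := by
  have hmem : ∀ t ∈ Icc (0 : ℝ) 1, x + t • (w - x) ∈ S := fun t ht =>
    hφ.1.add_smul_sub_mem hx hw ht
  have hcv : ConvexOn ℝ (Icc (0 : ℝ) 1) (fun r : ℝ => φ (x + r • (w - x))) := by
    refine ⟨convex_Icc 0 1, fun r hr t ht a b ha hb hab => ?_⟩
    have e : x + (a • r + b • t) • (w - x) = a • (x + r • (w - x)) + b • (x + t • (w - x)) := by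
      have : x = a • x + b • x := by rw [← add_smul, hab, one_smul]
      nth_rewrite 1 [this]
      simp only [smul_eq_mul]
      module
    simp only [e]
    exact hφ.2 (hmem r hr) (hmem t ht) ha hb hab
  have h1 : HasDerivAt (fun r : ℝ => φ (x + r • (w - x))) (inner ℝ (w - x) v) 0 :=
    HasGradientAt.hasDerivAt_segment (by simpa using h)
  have h2 := hcv.le_slope_of_hasDerivAt (left_mem_Icc.2 zero_le_one)
    (right_mem_Icc.2 zero_le_one) zero_lt_one h1
  simp only [slope_def_field, zero_smul, add_zero, one_smul, add_sub_cancel, sub_zero, div_one]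
    at h2
  linarith

theorem ConvexOn.inner_gradient_sub_nonneg (hφ : ConvexOn ℝ S φ) {x v x' v' : H} (hx : x ∈ S)
    (hx' : x' ∈ S) (h : HasGradientAt φ v x) (h' : HasGradientAt φ v' x') :
    0 ≤ inner ℝ (x - x') (v - v') := by
  have h1 := hφ.add_inner_le hx hx' h
  have h2 := hφ.add_inner_le hx' hx h'
  rw [← neg_sub x x', inner_neg_left] at h1
  rw [inner_sub_right]
  linarith

/-- Expansion of the regularisation terms around `x`. -/
theorem regularisation_expand {E : Type*} [NormedAddCommGroup E] [InnerProductSpace ℝ E]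
    (τ η : ℝ) (c x w : E) :
    η / 2 * ‖w‖ ^ 2 + τ / 2 * ‖w - c‖ ^ 2 = η / 2 * ‖x‖ ^ 2 + τ / 2 * ‖x - c‖ ^ 2
      + inner ℝ (w - x) (η • x + τ • (x - c)) + (η + τ) / 2 * ‖w - x‖ ^ 2 := by
  have h1 : ‖w‖ ^ 2 = ‖w - x‖ ^ 2 + 2 * inner ℝ (w - x) x + ‖x‖ ^ 2 := by
    rw [← norm_add_sq_real, sub_add_cancel]
  have h2 : ‖w - c‖ ^ 2 = ‖w - x‖ ^ 2 + 2 * inner ℝ (w - x) (x - c) + ‖x - c‖ ^ 2 := by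
    rw [← norm_add_sq_real, sub_add_sub_cancel]
  rw [inner_add_right, real_inner_smul_right, real_inner_smul_right, h1, h2]
  ring

/-- First-order optimality condition for a convex function with quadratic regularisation. -/
theorem ConvexOn.forall_reg_le_iff (hφ : ConvexOn ℝ S φ) {x v : H} (hx : x ∈ S)
    (h : HasGradientAt φ v x) {τ η : ℝ} (hτ : 0 ≤ τ) (hη : 0 ≤ η) (c : H) :
    (∀ w ∈ S, φ x + (η / 2 * ‖x‖ ^ 2 + τ / 2 * ‖x - c‖ ^ 2) ≤
      φ w + (η / 2 * ‖w‖ ^ 2 + τ / 2 * ‖w - c‖ ^ 2)) ↔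
    ∀ w ∈ S, 0 ≤ inner ℝ (w - x) (v + η • x + τ • (x - c)) := by
  constructor
  · intro hmin w hw
    -- the right derivative along the segment from `x` to `w` is nonnegative
    let p : ℝ → ℝ := fun t => φ (x + t • (w - x)) + t * inner ℝ (w - x) (η • x + τ • (x - c))
      + (η + τ) / 2 * ‖w - x‖ ^ 2 * t ^ 2
    have h1 : HasDerivAt (fun r : ℝ => φ (x + r • (w - x))) (inner ℝ (w - x) v) 0 :=
      HasGradientAt.hasDerivAt_segment (by simpa using h)
    have hp : HasDerivAt p (inner ℝ (w - x) (v + η • x + τ • (x - c))) 0 := by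
      have h2 := (h1.add ((hasDerivAt_id (0 : ℝ)).mul_const
        (inner ℝ (w - x) (η • x + τ • (x - c))))).add
        ((hasDerivAt_pow 2 (0 : ℝ)).const_mul ((η + τ) / 2 * ‖w - x‖ ^ 2))
      refine h2.congr_deriv ?_
      rw [add_assoc v, inner_add_right (w - x) v]
      simp
    have hlim := hasDerivAt_iff_tendsto_slope.1 hp
    have hlim' := hlim.mono_left
      (nhdsWithin_mono (0 : ℝ) (fun t (ht : t ∈ Ioi (0 : ℝ)) => (ne_of_gt ht : t ≠ 0)))
    refine ge_of_tendsto hlim' ?_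
    filter_upwards [Ioc_mem_nhdsGT (zero_lt_one (α := ℝ))] with t ht
    have hmem := hφ.1.add_smul_sub_mem hx hw ⟨ht.1.le, ht.2⟩
    have h3 := hmin _ hmem
    rw [regularisation_expand τ η c x (x + t • (w - x)), add_sub_cancel_left,
      real_inner_smul_left, norm_smul, mul_pow, Real.norm_eq_abs, sq_abs] at h3
    have h4 : 0 ≤ p t - p 0 := by
      simp only [p, zero_smul, add_zero]
      linarith
    rw [slope_def_field, sub_zero]
    exact div_nonneg h4 ht.1.le
  · intro hvi w hw
    have h1 := hφ.add_inner_le hx hw h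
    have h2 := hvi w hw
    rw [add_assoc v, inner_add_right] at h2
    have h3 : 0 ≤ (η + τ) / 2 * ‖w - x‖ ^ 2 := by positivity
    rw [regularisation_expand τ η c x w]
    linarith

end FirstOrder

/-! ### Joint strategies, unilateral deviations and the simplex -/

section Strategies

variable {N n M : ℕ}

@[simp] theorem augPair_fst (x : JointStrategy N n) (y : EuclideanSpace ℝ (Fin M)) :
    (augPair x y).fst = x := rfl

@[simp] theorem augPair_snd (x : JointStrategy N n) (y : EuclideanSpace ℝ (Fin M)) :
    (augPair x y).snd = y := rfl

theorem norm_augPair_sq (x : JointStrategy N n) (y : EuclideanSpace ℝ (Fin M)) :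
    ‖augPair x y‖ ^ 2 = ‖x‖ ^ 2 + ‖y‖ ^ 2 :=
  WithLp.prod_norm_sq_eq_of_L2 _

theorem deviate_self (x : JointStrategy N n) (i : Fin N) : deviate x i (x i) = x := by
  simp [deviate]

@[simp] theorem deviate_apply_same (x : JointStrategy N n) (i : Fin N)
    (ν : EuclideanSpace ℝ (Fin n)) : deviate x i ν i = ν := by
  simp [deviate]

theorem deviate_apply_of_ne (x : JointStrategy N n) {i j : Fin N} (h : j ≠ i)
    (ν : EuclideanSpace ℝ (Fin n)) : deviate x i ν j = x j := by
  simp [deviate, h]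

theorem norm_deviate_sub_le (x x' : JointStrategy N n) (i : Fin N)
    (ν : EuclideanSpace ℝ (Fin n)) : ‖deviate x i ν - deviate x' i ν‖ ≤ ‖x - x'‖ := by
  refine (sq_le_sq₀ (norm_nonneg _) (norm_nonneg _)).1 ?_
  rw [PiLp.norm_sq_eq_of_L2, PiLp.norm_sq_eq_of_L2]
  refine Finset.sum_le_sum fun j _ => ?_
  rcases eq_or_ne j i with rfl | hj
  · simp
  · simp [deviate_apply_of_ne _ hj]

theorem deviate_add (x : JointStrategy N n) (i : Fin N) (ν : EuclideanSpace ℝ (Fin n)) :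
    deviate x i ν = deviate x i 0 + WithLp.toLp 2 (Pi.single i ν) := by
  ext j : 1
  rcases eq_or_ne j i with rfl | hj
  · simp
  · simp [deviate_apply_of_ne _ hj, hj]

theorem inner_toLp_single (u : JointStrategy N n) (i : Fin N) (ν : EuclideanSpace ℝ (Fin n)) :
    inner ℝ (WithLp.toLp 2 (Pi.single i ν) : JointStrategy N n) u = inner ℝ ν (u i) := by
  rw [PiLp.inner_apply, Finset.sum_eq_single i]
  · simp
  · intro j _ hj
    simp [hj]
  · simp

theorem norm_deviate_sq (x : JointStrategy N n) (i : Fin N) (ν : EuclideanSpace ℝ (Fin n)) :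
    ‖deviate x i ν‖ ^ 2 = ‖ν‖ ^ 2 + ‖deviate x i 0‖ ^ 2 := by
  rw [deviate_add, add_comm, norm_add_sq_real, inner_toLp_single,
    ← real_inner_self_eq_norm_sq (WithLp.toLp 2 (Pi.single i ν) : JointStrategy N n),
    inner_toLp_single]
  simp

/-- The partial gradient of `h` in the strategy of agent `i` is block `i` of its gradient. -/
theorem HasGradientAt.deviate {h : JointStrategy N n → ℝ} {x v : JointStrategy N n} {i : Fin N}
    {ν : EuclideanSpace ℝ (Fin n)} (hh : HasGradientAt h v (deviate x i ν)) :
    HasGradientAt (fun μ => h (_root_.deviate x i μ)) (v i) ν := by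
  have h1 : HasFDerivAt (fun μ => _root_.deviate x i μ)
      ((PiLp.continuousLinearEquiv 2 ℝ
        (fun _ : Fin N => EuclideanSpace ℝ (Fin n))).symm.toContinuousLinearMap.comp
        (ContinuousLinearMap.pi (Pi.single i (ContinuousLinearMap.id ℝ _)))) ν :=
    ((PiLp.continuousLinearEquiv 2 ℝ
      (fun _ : Fin N => EuclideanSpace ℝ (Fin n))).symm.toContinuousLinearMap.hasFDerivAt).comp ν
      (hasFDerivAt_update x.ofLp ν)
  rw [hasGradientAt_iff_hasFDerivAt] at hh ⊢
  refine (hh.comp ν h1).congr_fderiv ?_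
  ext μ
  have e : (ContinuousLinearMap.pi (Pi.single i (ContinuousLinearMap.id ℝ
      (EuclideanSpace ℝ (Fin n))))) μ = (Pi.single i μ : Fin N → EuclideanSpace ℝ (Fin n)) := by
    ext j : 1
    rcases eq_or_ne j i with rfl | hj
    · simp
    · simp [hj]
  have := inner_toLp_single v i μ
  simp only [ContinuousLinearMap.comp_apply, e, InnerProductSpace.toDual_apply_apply]
  rw [real_inner_comm, real_inner_comm μ]
  exact this

theorem convex_simplex : Convex ℝ (simplex M) := by
  rintro u ⟨hu, hu'⟩ v ⟨hv, hv'⟩ a b ha hb hab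
  refine ⟨fun m => add_nonneg (mul_nonneg ha (hu m)) (mul_nonneg hb (hv m)), ?_⟩
  simp [Finset.sum_add_distrib, ← Finset.mul_sum, hu', hv', hab]

theorem simplex_eq_preimage : simplex M =
    (EuclideanSpace.equiv (Fin M) ℝ) ⁻¹' stdSimplex ℝ (Fin M) := by
  ext y
  rfl

theorem isCompact_simplex : IsCompact (simplex M) := by
  rw [simplex_eq_preimage]
  exact (EuclideanSpace.equiv (Fin M) ℝ).toHomeomorph.isCompact_preimage.2
    (isCompact_stdSimplex ℝ (Fin M))

theorem single_mem_simplex (m : Fin M) : EuclideanSpace.single m (1 : ℝ) ∈ simplex M := by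
  refine ⟨fun j => ?_, ?_⟩
  · rw [PiLp.single_apply]
    split_ifs <;> norm_num
  · simp

theorem simplex_nonempty (hM : 1 ≤ M) : (simplex M).Nonempty :=
  ⟨_, single_mem_simplex ⟨0, hM⟩⟩

end Strategies

namespace ScenarioGame

variable {N n M : ℕ} {Θ : Type*} {G : ScenarioGame N n Θ} (θ : Fin M → Θ)

/-! ### The feasible set and the operator of the augmented game -/

theorem deviate_mem_strategies {x : JointStrategy N n} (hx : x ∈ G.strategies) {i : Fin N}
    {ν : EuclideanSpace ℝ (Fin n)} (hν : ν ∈ G.X i) : deviate x i ν ∈ G.strategies := by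
  intro j
  rcases eq_or_ne j i with rfl | hj
  · simpa using hν
  · rw [deviate_apply_of_ne _ hj]
    exact hx j

theorem StandingAssumption.convex_strategies (hG : G.StandingAssumption) :
    Convex ℝ G.strategies :=
  fun _ hu _ hv _ _ ha hb hab i => hG.convex i (hu i) (hv i) ha hb hab

theorem StandingAssumption.isCompact_strategies (hG : G.StandingAssumption) :
    IsCompact G.strategies := by
  have h := isCompact_univ_pi hG.compact
  have e : G.strategies =
      (PiLp.continuousLinearEquiv 2 ℝ (fun _ : Fin N => EuclideanSpace ℝ (Fin n))) ⁻¹'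
        (univ.pi G.X) := by
    ext x
    simp [strategies]
  rw [e]
  exact (PiLp.continuousLinearEquiv 2 ℝ
    (fun _ : Fin N => EuclideanSpace ℝ (Fin n))).toHomeomorph.isCompact_preimage.2 h

theorem StandingAssumption.convex_feasible (hG : G.StandingAssumption) :
    Convex ℝ (G.feasible M) :=
  fun _ hu _ hv _ _ ha hb hab =>
    ⟨hG.convex_strategies hu.1 hv.1 ha hb hab, convex_simplex hu.2 hv.2 ha hb hab⟩

theorem StandingAssumption.isCompact_feasible (hG : G.StandingAssumption) :
    IsCompact (G.feasible M) := by
  have e : G.feasible M = (WithLp.prodContinuousLinearEquiv 2 ℝ (JointStrategy N n)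
      (EuclideanSpace ℝ (Fin M))) ⁻¹' (G.strategies ×ˢ simplex M) := by
    ext x
    rfl
  rw [e]
  exact (WithLp.prodContinuousLinearEquiv 2 ℝ (JointStrategy N n)
    (EuclideanSpace ℝ (Fin M))).toHomeomorph.isCompact_preimage.2
    (hG.isCompact_strategies.prod isCompact_simplex)

theorem StandingAssumption.feasible_nonempty (hG : G.StandingAssumption) (hM : 1 ≤ M) :
    (G.feasible M).Nonempty := by
  choose x hx using hG.nonempty
  obtain ⟨y, hy⟩ := simplex_nonempty hM
  exact ⟨augPair (WithLp.toLp 2 x) y, hx, hy⟩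

theorem _root_.TwiceDifferentiableNear.differentiableAt {S : Set (JointStrategy N n)}
    {h : JointStrategy N n → ℝ} (hh : TwiceDifferentiableNear S h) {x : JointStrategy N n}
    (hx : x ∈ S) : DifferentiableAt ℝ h x := by
  obtain ⟨U, hU, -, hSU, hd, -⟩ := hh
  exact hd.differentiableAt (hU.mem_nhds (hSU hx))

theorem _root_.TwiceDifferentiableNear.continuousAt_gradient {S : Set (JointStrategy N n)}
    {h : JointStrategy N n → ℝ} (hh : TwiceDifferentiableNear S h) {x : JointStrategy N n}
    (hx : x ∈ S) : ContinuousAt (gradient h) x := by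
  obtain ⟨U, hU, -, hSU, -, hd⟩ := hh
  exact continuousAt_gradient_of_differentiableOn_fderiv hU hd (hSU hx)

theorem _root_.TwiceContDifferentiableNear.contDiffAt {S : Set (JointStrategy N n)}
    {h : JointStrategy N n → ℝ} (hh : TwiceContDifferentiableNear S h) {x : JointStrategy N n}
    (hx : x ∈ S) : ContDiffAt ℝ 2 h x := by
  obtain ⟨U, hU, -, hSU, hd⟩ := hh
  exact hd.contDiffAt (hU.mem_nhds (hSU hx))

theorem _root_.TwiceContDifferentiableNear.contDiffAt_gradient {S : Set (JointStrategy N n)}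
    {h : JointStrategy N n → ℝ} (hh : TwiceContDifferentiableNear S h) {x : JointStrategy N n}
    (hx : x ∈ S) : ContDiffAt ℝ 1 (gradient h) x :=
  ((InnerProductSpace.toDual ℝ (JointStrategy N n)).symm.toContinuousLinearEquiv.contDiff.contDiffAt
    (n := 1)).comp x ((hh.contDiffAt hx).fderiv_right (m := 1) (by norm_num))

variable (G) in
/-- The agents' part `((∇_{x_i} f_i(x) + ∑_m y_m ∇_{x_i} g(x, θ_m))_i)` of the augmented
operator. -/
noncomputable def agentForce (x : JointStrategy N n) (y : EuclideanSpace ℝ (Fin M)) :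
    JointStrategy N n :=
  G.pseudoGradient x + ∑ m, y m • gradient (fun x => G.g x (θ m)) x

variable (G) in
/-- The vector `(g(x, θ_m))_m` of the uncertain costs at the samples. -/
noncomputable def costVector (x : JointStrategy N n) : EuclideanSpace ℝ (Fin M) :=
  WithLp.toLp 2 fun m => G.g x (θ m)

theorem gHat_eq_inner (x : JointStrategy N n) (y : EuclideanSpace ℝ (Fin M)) :
    G.gHat θ x y = inner ℝ (G.costVector θ x) y := by
  simp [gHat, costVector, PiLp.inner_apply]

theorem gradient_gHat_snd (x : JointStrategy N n) (y : EuclideanSpace ℝ (Fin M)) :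
    gradient (fun y => G.gHat θ x y) y = G.costVector θ x := by
  refine HasGradientAt.gradient ?_
  rw [hasGradientAt_iff_hasFDerivAt]
  simp only [gHat_eq_inner]
  exact (InnerProductSpace.toDual ℝ _ (G.costVector θ x)).hasFDerivAt

theorem StandingAssumption.hasGradientAt_gHat (hG : G.StandingAssumption) {x : JointStrategy N n}
    (hx : x ∈ G.strategies) (y : EuclideanSpace ℝ (Fin M)) :
    HasGradientAt (fun x => G.gHat θ x y) (∑ m, y m • gradient (fun x => G.g x (θ m)) x) x := by
  rw [hasGradientAt_iff_hasFDerivAt, map_sum]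
  simp only [gHat]
  refine HasFDerivAt.fun_sum fun m _ => ?_
  rw [map_smul]
  exact ((hG.diff_g (θ m)).differentiableAt hx).hasGradientAt.hasFDerivAt.const_mul (y m)

theorem StandingAssumption.augOperator_eq (hG : G.StandingAssumption)
    {z : AugmentedStrategy N n M} (hz : z.fst ∈ G.strategies) :
    G.augOperator θ z = augPair (G.agentForce θ z.fst z.snd) (-G.costVector θ z.fst) := by
  rw [augOperator, gradient_gHat_snd, (hG.hasGradientAt_gHat θ hz z.snd).gradient, agentForce]

theorem StandingAssumption.continuousOn_augOperator (hG : G.StandingAssumption) :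
    ContinuousOn (G.augOperator θ) (G.feasible M) := by
  refine ContinuousOn.congr (f := fun z : AugmentedStrategy N n M =>
    augPair (G.agentForce θ z.fst z.snd) (-G.costVector θ z.fst)) (fun z hz => ?_)
    fun z hz => hG.augOperator_eq θ hz.1
  refine ContinuousAt.continuousWithinAt ?_
  have h1 : Continuous fun z : AugmentedStrategy N n M => z.fst :=
    (WithLp.fstL 2 ℝ (JointStrategy N n) (EuclideanSpace ℝ (Fin M))).continuous
  have h2 : Continuous fun z : AugmentedStrategy N n M => z.snd :=
    (WithLp.sndL 2 ℝ (JointStrategy N n) (EuclideanSpace ℝ (Fin M))).continuous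
  have hgrad : ∀ {h : JointStrategy N n → ℝ}, TwiceDifferentiableNear G.strategies h →
      ContinuousAt (fun w : AugmentedStrategy N n M => gradient h w.fst) z := fun hh =>
    ContinuousAt.comp (f := fun w : AugmentedStrategy N n M => w.fst)
      (hh.continuousAt_gradient hz.1) h1.continuousAt
  have hp : ContinuousAt (fun w : AugmentedStrategy N n M => G.pseudoGradient w.fst) z := by
    have h3 : ContinuousAt (fun (w : AugmentedStrategy N n M) i => gradient (G.f i) w.fst i) z :=
      continuousAt_pi.2 fun i =>
        ContinuousAt.comp (g := fun u : JointStrategy N n => u i)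
          (PiLp.continuous_apply 2 _ i).continuousAt (hgrad (hG.diff_f i))
    exact ContinuousAt.comp (g := WithLp.toLp 2) (PiLp.continuous_toLp 2 _).continuousAt h3
  have hc : ContinuousAt (fun w : AugmentedStrategy N n M => G.costVector θ w.fst) z := by
    have h3 : ContinuousAt (fun (w : AugmentedStrategy N n M) m => G.g w.fst (θ m)) z :=
      continuousAt_pi.2 fun m =>
        ContinuousAt.comp (f := fun w : AugmentedStrategy N n M => w.fst)
          ((hG.diff_g (θ m)).differentiableAt hz.1).hasGradientAt.continuousAt h1.continuousAt
    exact ContinuousAt.comp (g := WithLp.toLp 2) (PiLp.continuous_toLp 2 _).continuousAt h3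
  have hf : ContinuousAt (fun w : AugmentedStrategy N n M => G.agentForce θ w.fst w.snd) z := by
    have h3 : ContinuousAt (fun w : AugmentedStrategy N n M =>
        ∑ m, w.snd m • gradient (fun x => G.g x (θ m)) w.fst) z :=
      tendsto_finsetSum _ fun m _ => Tendsto.smul
        ((PiLp.continuous_apply 2 _ m).comp h2).continuousAt.tendsto
        (hgrad (hG.diff_g (θ m))).tendsto
    exact hp.add h3
  exact ContinuousAt.comp (g := WithLp.toLp 2) (WithLp.prod_continuous_toLp 2 _ _).continuousAt
    (hf.prodMk hc.neg)

/-- The augmented operator is monotone: the bilinear coupling of agents and additional player is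
skew up to the curvature of `g`, which is compensated by that of the `f_i`. -/
theorem StandingAssumption.monotone_augOperator (hG : G.StandingAssumption) :
    MonotoneOperatorOn (G.augOperator θ) (G.feasible M) := by
  obtain ⟨χf, χg, hχ, hf, hg⟩ := hG.monotone
  have hquad : ∀ u ∈ G.strategies, ∀ v ∈ G.strategies, ∀ y ∈ simplex M,
      inner ℝ (v - u) (∑ m, y m • gradient (fun x => G.g x (θ m)) u) + χg / 2 * ‖v - u‖ ^ 2 ≤
        inner ℝ y (G.costVector θ v - G.costVector θ u) := by
    intro u hu v hv y hy
    have h1 : ∀ m, y m * (inner ℝ (v - u) (gradient (fun x => G.g x (θ m)) u)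
        + χg / 2 * ‖v - u‖ ^ 2) ≤ y m * (G.g v (θ m) - G.g u (θ m)) := fun m => by
      have := add_inner_add_le_of_gradient_monotone hG.convex_strategies
        (fun x hx => (hG.diff_g (θ m)).differentiableAt hx) (hg (θ m)) hu hv
      exact mul_le_mul_of_nonneg_left (by linarith) (hy.1 m)
    have h2 := Finset.sum_le_sum fun m (_ : m ∈ Finset.univ) => h1 m
    simp only [mul_add, Finset.sum_add_distrib] at h2
    rw [← Finset.sum_mul, hy.2, one_mul] at h2
    rw [inner_sum]
    simp only [real_inner_smul_right]
    refine h2.trans_eq ?_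
    simp [costVector, PiLp.inner_apply, mul_comm]
  intro u hu v hv
  rw [hG.augOperator_eq θ hu.1, hG.augOperator_eq θ hv.1, WithLp.prod_inner_apply]
  have h1 := hf _ hu.1 _ hv.1
  have h2 := hquad _ hu.1 _ hv.1 _ hu.2
  have h3 := hquad _ hv.1 _ hu.1 _ hv.2
  rw [norm_sub_rev, ← neg_sub, inner_neg_left] at h2
  have e1 : inner ℝ (u - v).fst
      (augPair (G.agentForce θ u.fst u.snd) (-G.costVector θ u.fst) -
        augPair (G.agentForce θ v.fst v.snd) (-G.costVector θ v.fst)).fst =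
      inner ℝ (u.fst - v.fst) (G.pseudoGradient u.fst - G.pseudoGradient v.fst)
      + inner ℝ (u.fst - v.fst) (∑ m, u.snd m • gradient (fun x => G.g x (θ m)) u.fst)
      - inner ℝ (u.fst - v.fst) (∑ m, v.snd m • gradient (fun x => G.g x (θ m)) v.fst) := by
    rw [← inner_add_right, ← inner_sub_right]
    congr 1
    simp only [agentForce, WithLp.sub_fst, augPair_fst]
    abel
  have e2 : inner ℝ (u - v).snd
      (augPair (G.agentForce θ u.fst u.snd) (-G.costVector θ u.fst) -
        augPair (G.agentForce θ v.fst v.snd) (-G.costVector θ v.fst)).snd =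
      inner ℝ u.snd (G.costVector θ v.fst - G.costVector θ u.fst) +
      inner ℝ v.snd (G.costVector θ u.fst - G.costVector θ v.fst) := by
    simp only [WithLp.sub_snd, augPair_snd, inner_sub_left, inner_sub_right, inner_neg_right]
    ring
  have h4 := mul_nonneg hχ (sq_nonneg ‖u.fst - v.fst‖)
  have e0 : inner ℝ (u - v).ofLp.1
      (augPair (G.agentForce θ u.fst u.snd) (-G.costVector θ u.fst) -
        augPair (G.agentForce θ v.fst v.snd) (-G.costVector θ v.fst)).ofLp.1 +
      inner ℝ (u - v).ofLp.2
      (augPair (G.agentForce θ u.fst u.snd) (-G.costVector θ u.fst) -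
        augPair (G.agentForce θ v.fst v.snd) (-G.costVector θ v.fst)).ofLp.2 = _ :=
    congrArg₂ (· + ·) e1 e2
  rw [e0]
  linarith

/-! ### Optimal replies as variational inequalities -/

theorem StandingAssumption.convexOn_augCost (hG : G.StandingAssumption)
    {w : AugmentedStrategy N n M} (hw : w ∈ G.feasible M) (i : Fin N) :
    ConvexOn ℝ (G.X i) fun ν => G.f i (deviate w.fst i ν) + G.gHat θ (deviate w.fst i ν) w.snd := by
  -- the convexity assumption concerns `f_i + g(·, ϑ)`, so `f_i` is written as `∑ y_m f_i`
  have e : (fun ν => G.f i (deviate w.fst i ν) + G.gHat θ (deviate w.fst i ν) w.snd) =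
      fun ν => ∑ m, w.snd m • (G.f i (deviate w.fst i ν) + G.g (deviate w.fst i ν) (θ m)) := by
    funext ν
    simp only [smul_eq_mul, mul_add, Finset.sum_add_distrib, gHat]
    rw [← Finset.sum_mul, hw.2.2, one_mul]
  rw [e]
  refine ⟨hG.convex i, fun u hu v hv a b ha hb hab => ?_⟩
  simp only [Finset.smul_sum, ← Finset.sum_add_distrib]
  refine Finset.sum_le_sum fun m _ => ?_
  exact ((hG.convex_cost i (θ m) w.fst hw.1).smul (hw.2.1 m)).2 hu hv ha hb hab

theorem StandingAssumption.hasGradientAt_augCost (hG : G.StandingAssumption)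
    {w : AugmentedStrategy N n M} (hw : w ∈ G.feasible M) {i : Fin N}
    {ν : EuclideanSpace ℝ (Fin n)} (hν : ν ∈ G.X i) :
    HasGradientAt (fun ν => G.f i (deviate w.fst i ν) + G.gHat θ (deviate w.fst i ν) w.snd)
      (G.agentForce θ (deviate w.fst i ν) w.snd i) ν := by
  have hx := deviate_mem_strategies hw.1 hν
  have h : HasGradientAt (fun x => G.f i x + G.gHat θ x w.snd)
      (gradient (G.f i) (deviate w.fst i ν)
        + ∑ m, w.snd m • gradient (fun x => G.g x (θ m)) (deviate w.fst i ν))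
      (deviate w.fst i ν) := by
    rw [hasGradientAt_iff_hasFDerivAt, map_add]
    exact ((hG.diff_f i).differentiableAt hx).hasGradientAt.hasFDerivAt.add
      (hG.hasGradientAt_gHat θ hx w.snd).hasFDerivAt
  exact h.deviate

theorem regAgentCost_eq (τ η : ℝ) (c w : AugmentedStrategy N n M) (i : Fin N)
    (ν : EuclideanSpace ℝ (Fin n)) :
    G.regAgentCost θ τ η c w i ν =
      G.f i (deviate w.fst i ν) + G.gHat θ (deviate w.fst i ν) w.snd
        + (η / 2 * ‖ν‖ ^ 2 + τ / 2 * ‖ν - c.fst i‖ ^ 2)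
        + η / 2 * (‖deviate w.fst i 0‖ ^ 2 + ‖w.snd‖ ^ 2) := by
  rw [regAgentCost, norm_augPair_sq, norm_deviate_sq]
  ring

theorem regCoordPayoff_eq (τ η : ℝ) (c w : AugmentedStrategy N n M)
    (ν : EuclideanSpace ℝ (Fin M)) :
    G.regCoordPayoff θ τ η c w ν =
      -(inner ℝ (-G.costVector θ w.fst) ν + (η / 2 * ‖ν‖ ^ 2 + τ / 2 * ‖ν - c.snd‖ ^ 2))
        - η / 2 * ‖w.fst‖ ^ 2 := by
  rw [regCoordPayoff, norm_augPair_sq, gHat_eq_inner, inner_neg_left]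
  ring

/-- The optimal replies of the `N + 1` players, characterised by their first-order conditions. -/
theorem StandingAssumption.isBestResponse_iff (hG : G.StandingAssumption) {τ η : ℝ} (hτ : 0 ≤ τ)
    (hη : 0 ≤ η) (c : AugmentedStrategy N n M) {w w' : AugmentedStrategy N n M}
    (hw : w ∈ G.feasible M) :
    G.IsBestResponse θ τ η c w w' ↔
      (∀ i, w'.fst i ∈ G.X i ∧ ∀ ν ∈ G.X i, 0 ≤ inner ℝ (ν - w'.fst i)
        (G.agentForce θ (deviate w.fst i (w'.fst i)) w.snd i + η • w'.fst i
          + τ • (w'.fst i - c.fst i))) ∧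
      (w'.snd ∈ simplex M ∧ ∀ ν ∈ simplex M, 0 ≤ inner ℝ (ν - w'.snd)
        (-G.costVector θ w.fst + η • w'.snd + τ • (w'.snd - c.snd))) := by
  rw [IsBestResponse]
  refine and_congr (forall_congr' fun i => and_congr_right fun hi => ?_)
    (and_congr_right fun hy => ?_)
  · rw [← (hG.convexOn_augCost θ hw i).forall_reg_le_iff hi (hG.hasGradientAt_augCost θ hw hi)
      hτ hη (c.fst i)]
    simp only [regAgentCost_eq, add_le_add_iff_right]
  · have hlin : ConvexOn ℝ (simplex M) fun ν : EuclideanSpace ℝ (Fin M) =>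
        inner ℝ (-G.costVector θ w.fst) ν :=
      (innerₛₗ ℝ (-G.costVector θ w.fst)).convexOn convex_simplex
    have hgrad : HasGradientAt (fun ν : EuclideanSpace ℝ (Fin M) =>
        inner ℝ (-G.costVector θ w.fst) ν) (-G.costVector θ w.fst) w'.snd :=
      (InnerProductSpace.toDual ℝ _ (-G.costVector θ w.fst)).hasFDerivAt
    rw [← hlin.forall_reg_le_iff hy hgrad hτ hη c.snd]
    simp only [regCoordPayoff_eq, sub_le_sub_iff_right, neg_le_neg_iff]

theorem IsBestResponse.mem_feasible {τ η : ℝ} {c w w' : AugmentedStrategy N n M}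
    (h : G.IsBestResponse θ τ η c w w') : w' ∈ G.feasible M :=
  ⟨fun i => (h.1 i).1, h.2.1⟩

/-- The Nash equilibria of the regularised game solve the regularised variational inequality,
and conversely. -/
theorem StandingAssumption.isRegNash_iff (hG : G.StandingAssumption) {τ η : ℝ} (hτ : 0 ≤ τ)
    (hη : 0 ≤ η) (c : AugmentedStrategy N n M) {z : AugmentedStrategy N n M} :
    G.IsRegNash θ τ η c z ↔ z ∈ viSet (regOperator (G.augOperator θ) τ η c) (G.feasible M) := by
  have hinner : z ∈ G.feasible M → ∀ w : AugmentedStrategy N n M,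
      inner ℝ (w - z) (regOperator (G.augOperator θ) τ η c z) =
        ∑ i, inner ℝ (w.fst i - z.fst i)
          (G.agentForce θ z.fst z.snd i + η • z.fst i + τ • (z.fst i - c.fst i)) +
        inner ℝ (w.snd - z.snd)
          (-G.costVector θ z.fst + η • z.snd + τ • (z.snd - c.snd)) := by
    intro hz w
    rw [regOperator, hG.augOperator_eq θ hz.1, WithLp.prod_inner_apply, PiLp.inner_apply]
    rfl
  constructor
  · intro h
    have hz := h.mem_feasible
    refine ⟨hz, fun w hw => ?_⟩
    obtain ⟨h1, -, h2⟩ := (hG.isBestResponse_iff θ hτ hη c hz).1 h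
    rw [hinner hz]
    refine add_nonneg (Finset.sum_nonneg fun i _ => ?_) (h2 _ hw.2)
    have := (h1 i).2 _ (hw.1 i)
    rwa [deviate_self] at this
  · rintro ⟨hz, h⟩
    rw [IsRegNash, hG.isBestResponse_iff θ hτ hη c hz]
    refine ⟨fun i => ⟨hz.1 i, fun ν hν => ?_⟩, hz.2, fun ν hν => ?_⟩
    · have h1 := h (augPair (deviate z.fst i ν) z.snd) ⟨deviate_mem_strategies hz.1 hν, hz.2⟩
      rw [hinner hz, augPair_fst, augPair_snd, sub_self, inner_zero_left, add_zero,
        Finset.sum_eq_single i, deviate_apply_same] at h1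
      · rwa [deviate_self]
      · intro j _ hj
        rw [deviate_apply_of_ne _ hj, sub_self, inner_zero_left]
      · simp
    · have h1 := h (augPair z.fst ν) ⟨hz.1, hν⟩
      rw [hinner hz, augPair_fst, augPair_snd] at h1
      simpa using h1

/-- The agents' part of a solution of the augmented variational inequality is a Nash equilibrium
of the scenario game. -/
theorem StandingAssumption.fst_mem_nashSet (hG : G.StandingAssumption) (hM : 1 ≤ M)
    {z : AugmentedStrategy N n M} (hz : z ∈ G.viSolutions θ) : z.fst ∈ G.nashSet θ := by
  -- without regularisation (`τ = η = 0`) the equilibria of the game are the solutions of the VI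
  have hreg : G.IsRegNash θ 0 0 z z := by
    rw [hG.isRegNash_iff θ le_rfl le_rfl]
    refine ⟨hz.1, fun w hw => ?_⟩
    simpa [regOperator] using hz.2 w hw
  refine ⟨hz.1.1, fun i ν hν => ?_⟩
  have hx := (hreg.1 i).2 ν hν
  simp only [regAgentCost, zero_div, zero_mul, add_zero] at hx
  have hne : Nonempty (Fin M) := ⟨⟨0, hM⟩⟩
  have h1 : ⨆ m, G.g z.fst (θ m) ≤ G.gHat θ z.fst z.snd := by
    refine ciSup_le fun m => ?_
    have h := hreg.2.2 _ (single_mem_simplex m)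
    simpa [regCoordPayoff, gHat, PiLp.single_apply] using h
  have h2 : G.gHat θ (deviate z.fst i ν) z.snd ≤ ⨆ m, G.g (deviate z.fst i ν) (θ m) := by
    calc G.gHat θ (deviate z.fst i ν) z.snd
        ≤ ∑ m, z.snd m * ⨆ m, G.g (deviate z.fst i ν) (θ m) :=
          Finset.sum_le_sum fun m _ => mul_le_mul_of_nonneg_left
            (le_ciSup (f := fun m => G.g (deviate z.fst i ν) (θ m))
              (finite_range _).bddAbove m) (hz.1.2.1 m)
      _ = _ := by rw [← Finset.sum_mul, hz.1.2.2, one_mul]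
  rw [deviate_self] at hx ⊢
  simp only [cost]
  linarith

/-! ### Contractivity of the simultaneous optimal replies -/

/-- With continuous second derivatives, the augmented operator is Lipschitz on the compact
feasible set. -/
theorem StandingAssumption.exists_lipschitz_augOperator (hG : G.StandingAssumption)
    (hf : ∀ i, TwiceContDifferentiableNear G.strategies (G.f i))
    (hg : ∀ m, TwiceContDifferentiableNear G.strategies (fun x => G.g x (θ m))) :
    ∃ L : ℝ, 0 ≤ L ∧ ∀ u ∈ G.feasible M, ∀ v ∈ G.feasible M,
      ‖augPair (G.agentForce θ u.fst u.snd) (-G.costVector θ u.fst) -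
        augPair (G.agentForce θ v.fst v.snd) (-G.costVector θ v.fst)‖ ≤ L * ‖u - v‖ := by
  have hsmooth : ∀ z ∈ G.feasible M, ContDiffAt ℝ 1 (fun z : AugmentedStrategy N n M =>
      augPair (G.agentForce θ z.fst z.snd) (-G.costVector θ z.fst)) z := by
    intro z hz
    have h1 : ContDiffAt ℝ 1 (fun w : AugmentedStrategy N n M => w.fst) z :=
      (WithLp.fstL 2 ℝ (JointStrategy N n) (EuclideanSpace ℝ (Fin M))).contDiff.contDiffAt
    have h2 : ContDiffAt ℝ 1 (fun w : AugmentedStrategy N n M => w.snd) z :=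
      (WithLp.sndL 2 ℝ (JointStrategy N n) (EuclideanSpace ℝ (Fin M))).contDiff.contDiffAt
    have hgrad : ∀ {h : JointStrategy N n → ℝ}, TwiceContDifferentiableNear G.strategies h →
        ContDiffAt ℝ 1 (fun w : AugmentedStrategy N n M => gradient h w.fst) z := fun hh =>
      ContDiffAt.comp (f := fun w : AugmentedStrategy N n M => w.fst) z
        (hh.contDiffAt_gradient hz.1) h1
    have hp : ContDiffAt ℝ 1 (fun w : AugmentedStrategy N n M => G.pseudoGradient w.fst) z := by
      refine (contDiffAt_piLp 2).2 fun i => ?_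
      exact (contDiffAt_piLp 2).1 (hgrad (hf i)) i
    have hc : ContDiffAt ℝ 1 (fun w : AugmentedStrategy N n M => G.costVector θ w.fst) z := by
      refine (contDiffAt_piLp 2).2 fun m => ?_
      exact ContDiffAt.comp (f := fun w : AugmentedStrategy N n M => w.fst) z
        (((hg m).contDiffAt hz.1).of_le (by norm_num)) h1
    have hF : ContDiffAt ℝ 1 (fun w : AugmentedStrategy N n M =>
        G.agentForce θ w.fst w.snd) z := by
      refine hp.add (ContDiffAt.sum fun m _ => ?_)
      exact ((contDiffAt_piLp 2).1 h2 m).smul (hgrad (hg m))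
    exact ContDiffAt.comp z (g := (WithLp.prodContinuousLinearEquiv 2 ℝ (JointStrategy N n)
      (EuclideanSpace ℝ (Fin M))).symm) (ContinuousLinearEquiv.contDiff _).contDiffAt
      (hF.prodMk hc.neg)
  have hloc : LocallyLipschitzOn (G.feasible M) (fun z : AugmentedStrategy N n M =>
      augPair (G.agentForce θ z.fst z.snd) (-G.costVector θ z.fst)) := by
    intro z hz
    obtain ⟨K, t, ht, hK⟩ := (hsmooth z hz).exists_lipschitzOnWith
    exact ⟨K, t, mem_nhdsWithin_of_mem_nhds ht, hK⟩
  obtain ⟨K, hK⟩ := hloc.exists_lipschitzOnWith_of_compact hG.isCompact_feasible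
  exact ⟨K, K.2, fun u hu v hv => by simpa only [dist_eq_norm] using hK.dist_le_mul u hu v hv⟩

/-- Stability of regularised variational inequalities. Here `p` and `q` are the values of two
operators at their respective solutions `a` and `b`, and `r` is the value of the first operator
at `b`; only its monotonicity between `a` and `b` is used. -/
theorem mul_norm_sub_le_of_vi {E : Type*} [NormedAddCommGroup E] [InnerProductSpace ℝ E]
    {τ η : ℝ} (hη : 0 ≤ η) {a b c p q r : E}
    (ha : 0 ≤ inner ℝ (b - a) (p + η • a + τ • (a - c)))
    (hb : 0 ≤ inner ℝ (a - b) (q + η • b + τ • (b - c)))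
    (hpr : 0 ≤ inner ℝ (a - b) (p - r)) : τ * ‖a - b‖ ≤ ‖q - r‖ := by
  have e : p + η • a + τ • (a - c) - (q + η • b + τ • (b - c)) =
      (p - r) - (q - r) + (η + τ) • (a - b) := by module
  have h1 : (η + τ) * ‖a - b‖ ^ 2 ≤ inner ℝ (a - b) (q - r) := by
    rw [← neg_sub a b, inner_neg_left] at ha
    have h2 : inner ℝ (a - b) (p + η • a + τ • (a - c) - (q + η • b + τ • (b - c))) ≤ 0 := by
      rw [inner_sub_right]
      linarith
    rw [e, inner_add_right, inner_sub_right (a - b) (p - r), real_inner_smul_right,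
      real_inner_self_eq_norm_sq] at h2
    linarith
  have h3 := h1.trans (real_inner_le_norm _ _)
  rcases (norm_nonneg (a - b)).eq_or_lt with h0 | h0
  · rw [← h0, mul_zero]
    exact norm_nonneg _
  · refine le_of_mul_le_mul_left ?_ h0
    nlinarith [mul_nonneg hη (sq_nonneg ‖a - b‖)]

/-- For large `τ`, simultaneous optimal replies contract with factor `1/2`, uniformly in the
weight `η` and the centre. -/
theorem StandingAssumption.exists_contracting (hG : G.StandingAssumption)
    (hf : ∀ i, TwiceContDifferentiableNear G.strategies (G.f i))
    (hg : ∀ m, TwiceContDifferentiableNear G.strategies (fun x => G.g x (θ m))) :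
    ∃ τbar > 0, ∀ τ ≥ τbar, ∀ η ≥ 0, ∀ c v w v' w' : AugmentedStrategy N n M,
      v ∈ G.feasible M → w ∈ G.feasible M → G.IsBestResponse θ τ η c v v' →
      G.IsBestResponse θ τ η c w w' → ‖v' - w'‖ ≤ 1 / 2 * ‖v - w‖ := by
  obtain ⟨L, hL, hLip⟩ := hG.exists_lipschitz_augOperator θ hf hg
  refine ⟨2 * (N + 1) * L + 1, by positivity, fun τ hτbar η hη c v w v' w' hv hw hbv hbw => ?_⟩
  have hτ0 : 0 ≤ 2 * ((N : ℝ) + 1) * L := by positivity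
  have hτ : 0 < τ := by linarith
  have hv' := hbv.mem_feasible
  have hw' := hbw.mem_feasible
  obtain ⟨hv1, -, hv2⟩ := (hG.isBestResponse_iff θ hτ.le hη c hv).1 hbv
  obtain ⟨hw1, -, hw2⟩ := (hG.isBestResponse_iff θ hτ.le hη c hw).1 hbw
  have hfst : ∀ z : AugmentedStrategy N n M, ∀ i, ‖z.fst i‖ ≤ ‖z‖ := fun z i =>
    (PiLp.norm_apply_le z.fst i).trans (WithLp.norm_fst_le _ z)
  have hagent : ∀ i, τ * ‖v'.fst i - w'.fst i‖ ≤ L * ‖v - w‖ := by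
    intro i
    -- change the strategies of the others and of the additional player, keeping `w'_i` fixed
    set z₁ : AugmentedStrategy N n M := augPair (deviate w.fst i (w'.fst i)) w.snd
    set z₂ : AugmentedStrategy N n M := augPair (deviate v.fst i (w'.fst i)) v.snd
    have hz₁ : z₁ ∈ G.feasible M := ⟨deviate_mem_strategies hw.1 (hw'.1 i), hw.2⟩
    have hz₂ : z₂ ∈ G.feasible M := ⟨deviate_mem_strategies hv.1 (hw'.1 i), hv.2⟩
    have hd : ‖z₁ - z₂‖ ≤ ‖v - w‖ := by
      rw [norm_sub_rev v w]
      refine (sq_le_sq₀ (norm_nonneg _) (norm_nonneg _)).1 ?_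
      rw [WithLp.prod_norm_sq_eq_of_L2, WithLp.prod_norm_sq_eq_of_L2]
      exact add_le_add_left (pow_le_pow_left₀ (norm_nonneg _)
        (norm_deviate_sub_le w.fst v.fst i (w'.fst i)) 2) _
    refine (mul_norm_sub_le_of_vi hη ((hv1 i).2 _ (hw'.1 i)) ((hw1 i).2 _ (hv'.1 i))
      ((hG.convexOn_augCost θ hv i).inner_gradient_sub_nonneg (hv'.1 i) (hw'.1 i)
        (hG.hasGradientAt_augCost θ hv (hv'.1 i))
        (hG.hasGradientAt_augCost θ hv (hw'.1 i)))).trans ?_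
    exact (hfst (augPair (G.agentForce θ z₁.fst z₁.snd) (-G.costVector θ z₁.fst) -
      augPair (G.agentForce θ z₂.fst z₂.snd) (-G.costVector θ z₂.fst)) i).trans
      ((hLip _ hz₁ _ hz₂).trans (mul_le_mul_of_nonneg_left hd hL))
  have hcoord : τ * ‖v'.snd - w'.snd‖ ≤ L * ‖v - w‖ := by
    refine (mul_norm_sub_le_of_vi (r := -G.costVector θ v.fst) hη (hv2 _ hw'.2) (hw2 _ hv'.2)
      (by simp)).trans ?_
    rw [norm_sub_rev]
    exact (WithLp.norm_snd_le _ (augPair (G.agentForce θ v.fst v.snd) (-G.costVector θ v.fst) -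
      augPair (G.agentForce θ w.fst w.snd) (-G.costVector θ w.fst))).trans (hLip _ hv _ hw)
  set d := ‖v - w‖
  have hd0 : 0 ≤ d := norm_nonneg _
  have hsq : ∀ r : ℝ, 0 ≤ r → τ * r ≤ L * d → τ ^ 2 * r ^ 2 ≤ (L * d) ^ 2 := fun r hr h => by
    rw [← mul_pow]
    exact pow_le_pow_left₀ (by positivity) h 2
  have h1 : ‖v' - w'‖ ^ 2 = ∑ i, ‖v'.fst i - w'.fst i‖ ^ 2 + ‖v'.snd - w'.snd‖ ^ 2 := by
    rw [WithLp.prod_norm_sq_eq_of_L2, PiLp.norm_sq_eq_of_L2]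
    rfl
  have h2 : (τ * ‖v' - w'‖) ^ 2 ≤ (((N : ℝ) + 1) * (L * d)) ^ 2 := by
    calc (τ * ‖v' - w'‖) ^ 2
        = ∑ i, τ ^ 2 * ‖v'.fst i - w'.fst i‖ ^ 2 + τ ^ 2 * ‖v'.snd - w'.snd‖ ^ 2 := by
          rw [mul_pow, h1, mul_add, Finset.mul_sum]
      _ ≤ ∑ _i : Fin N, (L * d) ^ 2 + (L * d) ^ 2 :=
          add_le_add (Finset.sum_le_sum fun i _ => hsq _ (norm_nonneg _) (hagent i))
            (hsq _ (norm_nonneg _) hcoord)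
      _ = (N + 1) * (L * d) ^ 2 := by
          rw [Finset.sum_const, Finset.card_univ, Fintype.card_fin, nsmul_eq_mul]
          ring
      _ ≤ _ := by
          rw [mul_pow _ (L * d)]
          refine mul_le_mul_of_nonneg_right ?_ (sq_nonneg _)
          nlinarith [(Nat.cast_nonneg N : (0 : ℝ) ≤ N)]
  have h3 := (sq_le_sq₀ (by positivity) (by positivity)).1 h2
  refine le_of_mul_le_mul_left ?_ hτ
  nlinarith

/-- Optimal replies exist, by compactness of the strategy sets. -/
theorem StandingAssumption.exists_isBestResponse (hG : G.StandingAssumption) (hM : 1 ≤ M)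
    (τ η : ℝ) (c : AugmentedStrategy N n M) {w : AugmentedStrategy N n M}
    (hw : w ∈ G.feasible M) : ∃ w', G.IsBestResponse θ τ η c w w' := by
  have h1 : ∀ i, ∃ ν ∈ G.X i, IsMinOn (G.regAgentCost θ τ η c w i) (G.X i) ν := fun i => by
    refine (hG.compact i).exists_isMinOn (hG.nonempty i) ?_
    have hc : ContinuousOn (fun ν =>
        G.f i (deviate w.fst i ν) + G.gHat θ (deviate w.fst i ν) w.snd) (G.X i) := fun ν hν =>
      (hG.hasGradientAt_augCost θ hw hν).continuousAt.continuousWithinAt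
    refine ContinuousOn.congr ?_ fun ν _ => regAgentCost_eq θ τ η c w i ν
    exact (hc.add (by fun_prop)).add continuousOn_const
  have h2 : ∃ ν ∈ simplex M, IsMaxOn (G.regCoordPayoff θ τ η c w) (simplex M) ν := by
    refine isCompact_simplex.exists_isMaxOn (simplex_nonempty hM) ?_
    refine ContinuousOn.congr ?_ fun ν _ => regCoordPayoff_eq θ τ η c w ν
    fun_prop
  choose x hx hmin using h1
  obtain ⟨y, hy, hmax⟩ := h2
  exact ⟨augPair (WithLp.toLp 2 x) y, fun i => ⟨hx i, fun ν hν => hmin i hν⟩, hy,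
    fun ν hν => hmax hν⟩

/-! ### The inner loop -/

section InnerLoop

variable {θ} {τ η : ℝ} {c : AugmentedStrategy N n M}

theorem IsInnerOutput.mem_feasible {γ : ℝ} {w₀ out : AugmentedStrategy N n M}
    (h : G.IsInnerOutput θ τ η γ c w₀ out) : out ∈ G.feasible M := by
  obtain ⟨w, L, -, hw, -, -, rfl⟩ := h
  exact (hw L le_rfl).mem_feasible

variable (hcon : ∀ v w v' w' : AugmentedStrategy N n M, v ∈ G.feasible M → w ∈ G.feasible M →
  G.IsBestResponse θ τ η c v v' → G.IsBestResponse θ τ η c w w' → ‖v' - w'‖ ≤ 1 / 2 * ‖v - w‖)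
include hcon

/-- The inner loop stops, with a unique output. -/
theorem existsUnique_isInnerOutput
    (hex : ∀ w ∈ G.feasible M, ∃ w', G.IsBestResponse θ τ η c w w') {γ : ℝ} (hγ : 0 < γ)
    {w₀ : AugmentedStrategy N n M} (hw₀ : w₀ ∈ G.feasible M) :
    ∃! out, G.IsInnerOutput θ τ η γ c w₀ out := by
  choose! T hT using hex
  have huniq : ∀ w ∈ G.feasible M, ∀ w', G.IsBestResponse θ τ η c w w' → w' = T w := by
    intro w hw w' hw'
    have h := hcon w w w' (T w) hw hw hw' (hT w hw)
    rw [sub_self, norm_zero, mul_zero] at h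
    exact sub_eq_zero.1 (norm_le_zero_iff.1 h)
  set u : ℕ → AugmentedStrategy N n M := fun l => T^[l] w₀
  have hsucc : ∀ l, u (l + 1) = T (u l) := fun l => Function.iterate_succ_apply' T l w₀
  have hu : ∀ l, u l ∈ G.feasible M := fun l => by
    induction l with
    | zero => exact hw₀
    | succ l ih =>
      rw [hsucc]
      exact (hT _ ih).mem_feasible
  have hbr : ∀ l, G.IsBestResponse θ τ η c (u l) (u (l + 1)) := fun l => by
    rw [hsucc]
    exact hT _ (hu l)
  have hdecay : ∀ l, ‖u (l + 1) - u l‖ ≤ (1 / 2) ^ l * ‖u 1 - u 0‖ := fun l => by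
    induction l with
    | zero => simp
    | succ l ih =>
      rw [pow_succ']
      have := hcon _ _ _ _ (hu (l + 1)) (hu l) (hbr (l + 1)) (hbr l)
      linarith
  have hsmall : ∃ l, ‖u (l + 1) - u l‖ ≤ γ := by
    have h0 : Tendsto (fun l : ℕ => (1 / 2 : ℝ) ^ l * ‖u 1 - u 0‖) atTop (𝓝 0) := by
      simpa using (tendsto_pow_atTop_nhds_zero_of_lt_one (r := (1 / 2 : ℝ)) (by norm_num)
        (by norm_num)).mul_const ‖u 1 - u 0‖
    obtain ⟨l, hl⟩ := (h0.eventually (ge_mem_nhds hγ)).exists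
    exact ⟨l, (hdecay l).trans hl⟩
  classical
  refine ⟨u (Nat.find hsmall + 1), ⟨u, Nat.find hsmall, rfl, fun l _ => hbr l,
    fun l hl => not_le.1 (Nat.find_min hsmall hl), Nat.find_spec hsmall, rfl⟩, ?_⟩
  rintro _ ⟨w, L, rfl, hw, hlt, hle, rfl⟩
  have heq : ∀ l ≤ L + 1, w l = u l := fun l => by
    induction l with
    | zero => exact fun _ => rfl
    | succ l ih =>
      intro hl
      have h := hw l (by omega)
      rw [ih (by omega)] at h
      rw [huniq _ (hu l) _ h, hsucc]
  have hL : Nat.find hsmall = L := by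
    rw [Nat.find_eq_iff]
    refine ⟨?_, fun l hl => ?_⟩
    · rw [← heq (L + 1) le_rfl, ← heq L (by omega)]
      exact hle
    · rw [← heq (l + 1) (by omega), ← heq l (by omega)]
      exact not_le.2 (hlt l hl)
  rw [hL, heq (L + 1) le_rfl]

/-- The output of the inner loop is within its tolerance of the equilibrium, as the contraction
factor is `1/2`. -/
theorem IsInnerOutput.norm_sub_le {γ : ℝ} {w₀ out s : AugmentedStrategy N n M}
    (hw₀ : w₀ ∈ G.feasible M) (h : G.IsInnerOutput θ τ η γ c w₀ out)
    (hs : G.IsRegNash θ τ η c s) : ‖out - s‖ ≤ γ := by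
  obtain ⟨w, L, rfl, hw, -, hle, rfl⟩ := h
  have hmem : w L ∈ G.feasible M := by
    cases L with
    | zero => exact hw₀
    | succ L => exact (hw L (by omega)).mem_feasible
  have h1 := hcon _ _ _ _ hmem hs.mem_feasible (hw L le_rfl) hs
  have h2 := norm_sub_le_norm_sub_add_norm_sub (w L) (w (L + 1)) s
  rw [norm_sub_rev (w L) (w (L + 1))] at h2
  linarith

end InnerLoop

end ScenarioGame

/-! ### The equilibrium selection -/

theorem proposition1 {N n M : ℕ} {Θ : Type*} (hM : 1 ≤ M) (G : ScenarioGame N n Θ)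
    (hG : G.StandingAssumption) :
    ∃ Φ : ∀ θ : Fin M → Θ, G.nashSet θ, ∀ θ : Fin M → Θ,
      ∃ zs : AugmentedStrategy N n M,
        -- the selected equilibrium is the `x`-part of the unique minimum-norm solution of the VI
        G.minNormSolutions θ = {zs} ∧ zs.fst = (Φ θ : JointStrategy N n) ∧
        -- the regularised games have unique equilibria
        (∀ τ > 0, ∀ η ≥ 0, ∀ c ∈ G.feasible M, ∃! z, G.IsRegNash θ τ η c z) ∧
        -- the proximal-Tikhonov iteration (exact, or with summable errors) converges to `zs`
        (∀ τ > 0, ∀ η ε : ℕ → ℝ, ScenarioGame.IsTikhonovSeq η →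
          (∀ k, 0 ≤ ε k) → Summable ε →
          ∀ zbar : ℕ → AugmentedStrategy N n M, (∀ k, zbar k ∈ G.feasible M) →
            (∀ k, ∃ s, G.IsRegNash θ τ (η k) (zbar k) s ∧ ‖zbar (k + 1) - s‖ ≤ ε k) →
            Tendsto zbar atTop (𝓝 zs)) ∧
        -- decentralised implementation: for large `τ` the inner best-response loops stop,
        -- and the outer iterates converge to `zs`
        ((∀ i, TwiceContDifferentiableNear G.strategies (G.f i)) →
          (∀ m, TwiceContDifferentiableNear G.strategies (fun x => G.g x (θ m))) →
          ∃ τbar > 0, ∀ τ ≥ τbar,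
            (∀ η ≥ 0, ∀ γ > 0, ∀ c ∈ G.feasible M, ∀ w₀ ∈ G.feasible M,
              ∃! out, G.IsInnerOutput θ τ η γ c w₀ out) ∧
            (∀ η γ : ℕ → ℝ, ScenarioGame.IsTikhonovSeq η → (∀ k, 0 < γ k) → Summable γ →
              ∀ zbar : ℕ → AugmentedStrategy N n M, G.IsRun θ τ η γ zbar →
                Tendsto zbar atTop (𝓝 zs) ∧
                ∀ γout > 0, ∃ k, ‖zbar (k + 1) - zbar k‖ ≤ γout)) := by
  have hsel : ∀ θ : Fin M → Θ, ∃ p ∈ G.viSolutions θ,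
      (∀ q ∈ G.viSolutions θ, 0 ≤ inner ℝ p (q - p)) ∧ G.minNormSolutions θ = {p} := fun θ => by
    have hc := hG.continuousOn_augOperator θ
    have hm := hG.monotone_augOperator θ
    exact exists_unique_min_norm
      (viSet_nonempty (hG.feasible_nonempty hM) hG.isCompact_feasible hG.convex_feasible hc hm)
      (isCompact_viSet hG.isCompact_feasible hG.convex_feasible hc hm)
      (convex_viSet hG.convex_feasible hc hm)
  choose p hp hproj hmin using hsel
  refine ⟨fun θ => ⟨(p θ).fst, hG.fst_mem_nashSet θ hM (hp θ)⟩, fun θ => ⟨p θ, hmin θ, rfl, ?_⟩⟩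
  have hc := hG.continuousOn_augOperator θ
  have hm := hG.monotone_augOperator θ
  have hreg : ∀ τ > 0, ∀ η ≥ 0, ∀ c : AugmentedStrategy N n M,
      ∃! z, G.IsRegNash θ τ η c z := fun τ hτ η hη c => by
    simp only [hG.isRegNash_iff θ (le_of_lt hτ) hη]
    exact existsUnique_mem_viSet_regOperator (hG.feasible_nonempty hM) hG.isCompact_feasible
      hG.convex_feasible hc hm hτ hη c
  have hconv : ∀ τ > 0, ∀ η ε : ℕ → ℝ, ScenarioGame.IsTikhonovSeq η →
      (∀ k, 0 ≤ ε k) → Summable ε →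
      ∀ zbar : ℕ → AugmentedStrategy N n M, (∀ k, zbar k ∈ G.feasible M) →
        (∀ k, ∃ s, G.IsRegNash θ τ (η k) (zbar k) s ∧ ‖zbar (k + 1) - s‖ ≤ ε k) →
        Tendsto zbar atTop (𝓝 (p θ)) := by
    intro τ hτ η ε hη hε hεs zbar hz hs
    choose s hs hzs using hs
    exact tendsto_proxTikhonov hG.isCompact_feasible hc hm (hp θ) (hproj θ) hτ hη.1 hη.2.1 hη.2.2
      hε hεs hz (fun k => (hG.isRegNash_iff θ (le_of_lt hτ) (hη.1 k).le (zbar k)).1 (hs k)) hzs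
  refine ⟨fun τ hτ η hη c _ => hreg τ hτ η hη c, hconv, fun hf hg => ?_⟩
  obtain ⟨τbar, hτbar, hcon⟩ := hG.exists_contracting θ hf hg
  refine ⟨τbar, hτbar, fun τ hτ => ⟨fun η hη γ hγ c _ w₀ hw₀ => ?_, ?_⟩⟩
  · exact ScenarioGame.existsUnique_isInnerOutput (hcon τ hτ η hη c)
      (fun w hw => hG.exists_isBestResponse θ hM τ η c hw) hγ hw₀
  · intro η γ hη hγ hγs zbar ⟨h0, hrun⟩
    have hτ0 : 0 < τ := hτbar.trans_le hτ
    have hz : ∀ k, zbar k ∈ G.feasible M := fun k => by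
      cases k with
      | zero => exact h0
      | succ k =>
        obtain ⟨w₀, -, hout⟩ := hrun k
        exact hout.mem_feasible
    have hlim : Tendsto zbar atTop (𝓝 (p θ)) := by
      refine hconv τ hτ0 η γ hη (fun k => (hγ k).le) hγs zbar hz fun k => ?_
      obtain ⟨w₀, hw₀, hout⟩ := hrun k
      obtain ⟨s, hs, -⟩ := hreg τ hτ0 (η k) (hη.1 k).le (zbar k)
      exact ⟨s, hs, hout.norm_sub_le (hcon τ hτ (η k) (hη.1 k).le (zbar k)) hw₀ hs⟩
    refine ⟨hlim, fun γout hγout => ?_⟩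
    have hdiff : Tendsto (fun k => ‖zbar (k + 1) - zbar k‖) atTop (𝓝 0) := by
      simpa using ((hlim.comp (tendsto_add_atTop_nat 1)).sub hlim).norm
    exact (hdiff.eventually (ge_mem_nhds hγout)).exists
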